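/- Let $G$ be a locally compact, Hausdorff, second countable étale topological groupoid with unit space $G^{(0)}$, range and source maps $r,s$, and isotropy bundle $G'=\{\gamma\in G: r(\gamma)=s(\gamma)\}$. Let $\Sigma$ be a twist over $G$, i.e. a central extension of topological groupoids $\mathbf T\times G^{(0)}\to\Sigma\to G$, where $\mathbf T\times G^{(0)}$ is embedded in $\Sigma$ as a topological subgroupoid and $\Sigma/\mathbf T=G$ as topological spaces. Let $L=(\mathbf C\times\Sigma)/\mathbf T$ be the associated complex line bundle over $G$, whose sections are viewed as functions $f:\Sigma\to\mathbf C$ with $f(z\sigma)=f(\sigma)\overline z$ for $z\in\mathbf T$, $\sigma\in\Sigma$. Let $A=C^*_{red}(G,\Sigma)$ be the reduced C$^*$-algebra, that is, the completion of the convolution $*$-algebra $C_c(G,\Sigma)$ of continuous compactly supported sections of $L$ in the norm $\|f\|=\sup_{x\in G^{(0)}}\|\pi_x(f)\|$, where $\pi_x(f)\xi(\sigma)=\sum_{\dot\tau\in G_x}f(\sigma\tau^{-1})\xi(\tau)$ on the Hilbert space $H_x$ of square-summable sections of $L$ over $G_x=s^{-1}(x)$. Each $a\in A$ is viewed as a section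 of $L$ by $a(\sigma)=(\pi_{x}(a)\epsilon_{x})(\sigma)$, $x=s(\sigma)$, where $\epsilon_x\in H_x$ equals $\overline z$ at $(z,x)\in\mathbf T\times\{x\}$ and vanishes elsewhere (for $a=f\in C_c(G,\Sigma)$ this gives back $f$), and its open support is $\mathrm{supp}'(a)=\{\gamma\in G: a(\gamma)\neq0\}$. Let $B=C_0(G^{(0)})\subset A$, where $h\in C_0(G^{(0)})$ is the section equal to $h(x)\overline z$ at $(z,x)\in\mathbf T\times G^{(0)}$ and to $0$ elsewhere. Then: 1. an element $a\in A$ commutes with every element of $B$ if and only if $\mathrm{supp}'(a)\subset G'$; 2. $B$ is a maximal abelian self-adjoint subalgebra (masa) of $A$ if and only if $G$ is essentially principal, i.e. the interior of $G'$ in $G$ is $G^{(0)}$. -/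

import Mathlib

open scoped ENNReal ComplexConjugate

namespace TwistedGroupoid

/-- A groupoid given by its set `G` of arrows; units are identified with their identity arrows.
The value `mul a b` is meaningful only for composable pairs, i.e. when `s a = r b`;
no axiom restricts it elsewhere. -/
class ArrowGroupoid (G : Type*) where
  r : G → G
  s : G → G
  inv : G → G
  mul : G → G → G
  r_r : ∀ a, r (r a) = r a
  s_r : ∀ a, s (r a) = r a
  r_s : ∀ a, r (s a) = s a
  s_s : ∀ a, s (s a) = s a
  r_mul : ∀ a b, s a = r b → r (mul a b) = r a
  s_mul : ∀ a b, s a = r b → s (mul a b) = s b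
  mul_assoc : ∀ a b c, s a = r b → s b = r c → mul (mul a b) c = mul a (mul b c)
  r_mul_self : ∀ a, mul (r a) a = a
  mul_s_self : ∀ a, mul a (s a) = a
  r_inv : ∀ a, r (inv a) = s a
  s_inv : ∀ a, s (inv a) = r a
  mul_inv_self : ∀ a, mul a (inv a) = r a
  inv_mul_self : ∀ a, mul (inv a) a = s a

/-- The unit space `G⁽⁰⁾ ⊆ G`. -/
def unitSpace (G : Type*) [ArrowGroupoid G] : Set G := {a | ArrowGroupoid.r a = a}

/-- The isotropy bundle `G' = {γ | r γ = s γ}`. -/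
def isotropy (G : Type*) [ArrowGroupoid G] : Set G :=
  {a | ArrowGroupoid.r a = ArrowGroupoid.s a}

/-- The range map `G → G⁽⁰⁾`. -/
def rng {G : Type*} [ArrowGroupoid G] (a : G) : unitSpace G :=
  ⟨ArrowGroupoid.r a, ArrowGroupoid.r_r a⟩

/-- The source map `G → G⁽⁰⁾`. -/
def src {G : Type*} [ArrowGroupoid G] (a : G) : unitSpace G :=
  ⟨ArrowGroupoid.s a, ArrowGroupoid.r_s a⟩

/-- A topological groupoid: the structure maps are continuous (`mul` on the set of composable pairs
with the topology of `G × G`), and range and source are open onto `G⁽⁰⁾`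
with the topology induced by `G`. -/
class TopologicalGroupoid (G : Type*) [TopologicalSpace G] extends ArrowGroupoid G where
  continuous_r : Continuous r
  continuous_s : Continuous s
  continuous_inv : Continuous inv
  continuousOn_mul : ContinuousOn (fun p : G × G => mul p.1 p.2) {p | s p.1 = r p.2}
  isOpenMap_rng : IsOpenMap (rng : G → unitSpace G)
  isOpenMap_src : IsOpenMap (src : G → unitSpace G)

/-- A topological groupoid is étale when its range or source map is a local homeomorphism
onto the unit space. -/
class IsEtale (G : Type*) [TopologicalSpace G] [TopologicalGroupoid G] : Prop where
  isLocalHomeomorph : IsLocalHomeomorph (rng : G → unitSpace G) ∨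
    IsLocalHomeomorph (src : G → unitSpace G)

/-- `G` is essentially principal when the interior of the isotropy bundle is the unit space. -/
def IsEssentiallyPrincipal (G : Type*) [TopologicalSpace G] [TopologicalGroupoid G] : Prop :=
  interior (isotropy G) = unitSpace G

/-- A twist over `G`: a central extension of topological groupoids
`𝕋 × G⁽⁰⁾ → E → G`. Here `𝕋 × G⁽⁰⁾` is the trivial bundle of groups over `G⁽⁰⁾`, with units
`(1, x)`; it is a topological subgroupoid of `E`, and `E → G` is the (open) quotient map. -/
structure Twist (G E : Type*) [TopologicalSpace G] [TopologicalGroupoid G]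
    [TopologicalSpace E] [TopologicalGroupoid E] where
  incl : Circle × unitSpace G → E
  proj : E → G
  isEmbedding_incl : Topology.IsEmbedding incl
  r_incl : ∀ z x, ArrowGroupoid.r (incl (z, x)) = incl (1, x)
  s_incl : ∀ z x, ArrowGroupoid.s (incl (z, x)) = incl (1, x)
  incl_mul : ∀ z w x, incl (z * w, x) = ArrowGroupoid.mul (incl (z, x)) (incl (w, x))
  isOpenQuotientMap_proj : IsOpenQuotientMap proj
  proj_r : ∀ σ, proj (ArrowGroupoid.r σ) = ArrowGroupoid.r (proj σ)
  proj_s : ∀ σ, proj (ArrowGroupoid.s σ) = ArrowGroupoid.s (proj σ)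
  proj_mul : ∀ σ τ, ArrowGroupoid.s σ = ArrowGroupoid.r τ →
    proj (ArrowGroupoid.mul σ τ) = ArrowGroupoid.mul (proj σ) (proj τ)
  proj_incl : ∀ z x, proj (incl (z, x)) = (x : G)
  exact : ∀ σ, proj σ ∈ unitSpace G → ∃ z x, σ = incl (z, x)
  central : ∀ z σ, ArrowGroupoid.mul (incl (z, rng (proj σ))) σ =
    ArrowGroupoid.mul σ (incl (z, src (proj σ)))

/-! ### A boundedness criterion for sparse matrices -/

theorem sparse_bound {ι : Type*} (R : ι → Finset ι) (n : ℕ) (hrow : ∀ i, (R i).card ≤ n)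
    (hcol : ∀ (j : ι) (t : Finset ι), (∀ i ∈ t, j ∈ R i) → t.card ≤ n)
    (a b : ι → ℝ) (M : ℝ) (hb0 : ∀ i, 0 ≤ b i)
    (hb : ∀ i, b i ≤ M * ∑ j ∈ R i, a j) (hs : Summable fun j => a j ^ 2) (t : Finset ι) :
    ∑ i ∈ t, b i ^ 2 ≤ (n * M) ^ 2 * ∑' j, a j ^ 2 := by
  classical
  have h1 : ∀ i, b i ^ 2 ≤ n * M ^ 2 * ∑ j ∈ R i, a j ^ 2 := by
    intro i
    have h2 : (∑ j ∈ R i, a j) ^ 2 ≤ (R i).card * ∑ j ∈ R i, a j ^ 2 :=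
      sq_sum_le_card_mul_sum_sq
    have h3 : ((R i).card : ℝ) ≤ n := by exact_mod_cast hrow i
    have h4 : 0 ≤ ∑ j ∈ R i, a j ^ 2 := Finset.sum_nonneg fun j _ => sq_nonneg _
    calc b i ^ 2 ≤ (M * ∑ j ∈ R i, a j) ^ 2 := pow_le_pow_left₀ (hb0 i) (hb i) 2
      _ = M ^ 2 * (∑ j ∈ R i, a j) ^ 2 := by ring
      _ ≤ M ^ 2 * (n * ∑ j ∈ R i, a j ^ 2) := by
          apply mul_le_mul_of_nonneg_left _ (sq_nonneg M)
          exact h2.trans (mul_le_mul_of_nonneg_right h3 h4)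
      _ = _ := by ring
  have h5 : ∑ i ∈ t, ∑ j ∈ R i, a j ^ 2 ≤ n * ∑' j, a j ^ 2 := by
    have h6 : ∀ i ∈ t, ∑ j ∈ R i, a j ^ 2
        = ∑ j ∈ t.biUnion R, if j ∈ R i then a j ^ 2 else 0 := by
      intro i hi
      rw [← Finset.sum_filter]
      congr 1
      ext j
      simp only [Finset.mem_filter, Finset.mem_biUnion]
      exact ⟨fun h => ⟨⟨i, hi, h⟩, h⟩, fun h => h.2⟩
    rw [Finset.sum_congr rfl h6, Finset.sum_comm]
    calc _ ≤ ∑ j ∈ t.biUnion R, n * a j ^ 2 := by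
          apply Finset.sum_le_sum
          intro j _
          rw [← Finset.sum_filter, Finset.sum_const, nsmul_eq_mul]
          apply mul_le_mul_of_nonneg_right _ (sq_nonneg _)
          exact_mod_cast hcol j _ fun i hi => (Finset.mem_filter.1 hi).2
      _ = n * ∑ j ∈ t.biUnion R, a j ^ 2 := by rw [Finset.mul_sum]
      _ ≤ _ := by
          apply mul_le_mul_of_nonneg_left _ (Nat.cast_nonneg n)
          exact hs.sum_le_tsum _ fun j _ => sq_nonneg _
  calc ∑ i ∈ t, b i ^ 2 ≤ ∑ i ∈ t, n * M ^ 2 * ∑ j ∈ R i, a j ^ 2 :=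
        Finset.sum_le_sum fun i _ => h1 i
    _ = n * M ^ 2 * ∑ i ∈ t, ∑ j ∈ R i, a j ^ 2 := by rw [Finset.mul_sum]
    _ ≤ n * M ^ 2 * (n * ∑' j, a j ^ 2) :=
        mul_le_mul_of_nonneg_left h5 (by positivity)
    _ = _ := by ring

/-! ### Étale groupoids: compact sets meet the fibres in boundedly many points -/

section Etale

variable {G : Type*} [TopologicalSpace G] [TopologicalGroupoid G]

theorem mul_right_cancel' {a b c : G} (ha : ArrowGroupoid.s a = ArrowGroupoid.r c)
    (hb : ArrowGroupoid.s b = ArrowGroupoid.r c)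
    (h : ArrowGroupoid.mul a c = ArrowGroupoid.mul b c) : a = b := by
  have h1 : ∀ d : G, ArrowGroupoid.s d = ArrowGroupoid.r c →
      ArrowGroupoid.mul (ArrowGroupoid.mul d c) (ArrowGroupoid.inv c) = d := by
    intro d hd
    rw [ArrowGroupoid.mul_assoc _ _ _ hd (ArrowGroupoid.r_inv c).symm,
      ArrowGroupoid.mul_inv_self, ← hd, ArrowGroupoid.mul_s_self]
  rw [← h1 a ha, h, h1 b hb]

theorem inv_inv' (a : G) : ArrowGroupoid.inv (ArrowGroupoid.inv a) = a := by
  apply mul_right_cancel' (c := ArrowGroupoid.inv a)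
  · rw [ArrowGroupoid.s_inv]
  · rw [ArrowGroupoid.r_inv]
  · rw [ArrowGroupoid.inv_mul_self, ArrowGroupoid.mul_inv_self, ArrowGroupoid.s_inv]

theorem mul_left_cancel' {a b c : G} (ha : ArrowGroupoid.s c = ArrowGroupoid.r a)
    (hb : ArrowGroupoid.s c = ArrowGroupoid.r b)
    (h : ArrowGroupoid.mul c a = ArrowGroupoid.mul c b) : a = b := by
  have h1 : ∀ d : G, ArrowGroupoid.s c = ArrowGroupoid.r d →
      ArrowGroupoid.mul (ArrowGroupoid.inv c) (ArrowGroupoid.mul c d) = d := by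
    intro d hd
    rw [← ArrowGroupoid.mul_assoc _ _ _ (ArrowGroupoid.s_inv c) hd,
      ArrowGroupoid.inv_mul_self, hd, ArrowGroupoid.r_mul_self]
  rw [← h1 a ha, h, h1 b hb]

theorem rng_inv (a : G) : rng (ArrowGroupoid.inv a) = src a :=
  Subtype.ext (ArrowGroupoid.r_inv a)

theorem src_inv (a : G) : src (ArrowGroupoid.inv a) = rng a :=
  Subtype.ext (ArrowGroupoid.s_inv a)

variable (G) in
/-- The inverse map as a homeomorphism. -/
def invHomeo : G ≃ₜ G where
  toFun := ArrowGroupoid.inv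
  invFun := ArrowGroupoid.inv
  left_inv := inv_inv'
  right_inv := inv_inv'
  continuous_toFun := TopologicalGroupoid.continuous_inv
  continuous_invFun := TopologicalGroupoid.continuous_inv

variable (G) in
theorem isLocalHomeomorph_both [IsEtale G] :
    IsLocalHomeomorph (rng : G → unitSpace G) ∧ IsLocalHomeomorph (src : G → unitSpace G) := by
  have h1 : (rng : G → unitSpace G) ∘ invHomeo G = src := funext rng_inv
  have h2 : (src : G → unitSpace G) ∘ invHomeo G = rng := funext src_inv
  rcases IsEtale.isLocalHomeomorph (G := G) with h | h
  · exact ⟨h, h1 ▸ h.comp (invHomeo G).isLocalHomeomorph⟩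
  · exact ⟨h2 ▸ h.comp (invHomeo G).isLocalHomeomorph, h⟩

theorem exists_card_le {X Y : Type*} [TopologicalSpace X] [TopologicalSpace Y] {p : X → Y}
    (hp : IsLocalHomeomorph p) {K : Set X} (hK : IsCompact K) :
    ∃ n : ℕ, ∀ (y : Y) (t : Finset X), (∀ a ∈ t, a ∈ K ∧ p a = y) → t.card ≤ n := by
  classical
  choose e he1 he2 using hp
  obtain ⟨F, -, hF⟩ := hK.elim_nhds_subcover (fun x => (e x).source)
    (fun x _ => (e x).open_source.mem_nhds (he1 x))
  refine ⟨F.card, fun y t ht => ?_⟩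
  have h1 : ∀ a ∈ t, ∃ x ∈ F, a ∈ (e x).source := by
    intro a hat
    have := hF (ht a hat).1
    simpa using this
  choose! c hc1 hc2 using h1
  apply Finset.card_le_card_of_injOn c hc1
  intro a hat b hbt hab
  have h2 : a ∈ (e (c a)).source := hc2 a hat
  have h3 : b ∈ (e (c a)).source := by
    have := hc2 b hbt
    rwa [← hab] at this
  apply (e (c a)).injOn h2 h3
  rw [← he2]
  rw [(ht a hat).2, (ht b hbt).2]

end Etale

namespace Twist

section Basic

variable {G E : Type*} [TopologicalSpace G] [TopologicalGroupoid G]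
  [TopologicalSpace E] [TopologicalGroupoid E] (T : Twist G E)

theorem incl_one_rng (σ : E) : T.incl (1, rng (T.proj σ)) = ArrowGroupoid.r σ := by
  have h : T.proj (ArrowGroupoid.r σ) ∈ unitSpace G := by
    rw [T.proj_r]; exact ArrowGroupoid.r_r _
  obtain ⟨z, x, hx⟩ := T.exact _ h
  have h1 : (x : G) = ArrowGroupoid.r (T.proj σ) := by
    rw [← T.proj_r, hx, T.proj_incl]
  have h2 : x = rng (T.proj σ) := Subtype.ext h1
  rw [← h2, ← T.r_incl z x, ← hx, ArrowGroupoid.r_r]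

/-- The action of `𝕋` on `E`. -/
def act (z : Circle) (σ : E) : E := ArrowGroupoid.mul (T.incl (z, rng (T.proj σ))) σ

theorem s_incl_rng (z : Circle) (σ : E) :
    ArrowGroupoid.s (T.incl (z, rng (T.proj σ))) = ArrowGroupoid.r σ := by
  rw [T.s_incl, T.incl_one_rng]

theorem r_act (z : Circle) (σ : E) : ArrowGroupoid.r (T.act z σ) = ArrowGroupoid.r σ := by
  rw [act, ArrowGroupoid.r_mul _ _ (T.s_incl_rng z σ), T.r_incl, T.incl_one_rng]

theorem s_act (z : Circle) (σ : E) : ArrowGroupoid.s (T.act z σ) = ArrowGroupoid.s σ := by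
  rw [act, ArrowGroupoid.s_mul _ _ (T.s_incl_rng z σ)]

theorem proj_act (z : Circle) (σ : E) : T.proj (T.act z σ) = T.proj σ := by
  rw [act, T.proj_mul _ _ (T.s_incl_rng z σ), T.proj_incl]
  exact ArrowGroupoid.r_mul_self _

theorem act_mul (z : Circle) (σ τ : E) (h : ArrowGroupoid.s σ = ArrowGroupoid.r τ) :
    T.act z (ArrowGroupoid.mul σ τ) = ArrowGroupoid.mul (T.act z σ) τ := by
  have h1 : rng (T.proj (ArrowGroupoid.mul σ τ)) = rng (T.proj σ) := by
    apply Subtype.ext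
    change ArrowGroupoid.r _ = ArrowGroupoid.r _
    rw [← T.proj_r, ArrowGroupoid.r_mul _ _ h, T.proj_r]
  rw [act, h1, act, ArrowGroupoid.mul_assoc _ _ _ (T.s_incl_rng z σ) h]

theorem act_incl (z w : Circle) (x : unitSpace G) : T.act z (T.incl (w, x)) = T.incl (z * w, x) := by
  have h : rng (T.proj (T.incl (w, x))) = x := by
    apply Subtype.ext
    change ArrowGroupoid.r _ = _
    rw [T.proj_incl]; exact x.2
  rw [act, h, T.incl_mul]

theorem exists_act_eq {σ τ : E} (h : T.proj σ = T.proj τ) : ∃ z, σ = T.act z τ := by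
  have hs : ArrowGroupoid.s σ = ArrowGroupoid.s τ := by
    have h1 : ∀ ρ : E, ArrowGroupoid.s ρ = T.incl (1, src (T.proj ρ)) := by
      intro ρ
      have h2 := T.incl_one_rng (ArrowGroupoid.inv ρ)
      rw [ArrowGroupoid.r_inv] at h2
      rw [← h2]
      congr 2
      apply Subtype.ext
      change ArrowGroupoid.r _ = ArrowGroupoid.s _
      rw [← T.proj_r, ArrowGroupoid.r_inv, T.proj_s]
    rw [h1, h1, h]
  have hc : ArrowGroupoid.s σ = ArrowGroupoid.r (ArrowGroupoid.inv τ) := by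
    rw [ArrowGroupoid.r_inv, hs]
  have hp : T.proj (ArrowGroupoid.mul σ (ArrowGroupoid.inv τ))
      = T.proj (ArrowGroupoid.mul τ (ArrowGroupoid.inv τ)) := by
    rw [T.proj_mul _ _ hc, T.proj_mul _ _ (ArrowGroupoid.r_inv τ).symm, h]
  rw [ArrowGroupoid.mul_inv_self] at hp
  obtain ⟨z, x, hx⟩ := T.exact (ArrowGroupoid.mul σ (ArrowGroupoid.inv τ)) (by
    rw [hp, T.proj_r]; exact ArrowGroupoid.r_r _)
  have hx' : x = rng (T.proj τ) := by
    apply Subtype.ext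
    rw [← T.proj_incl z x, ← hx, hp, T.proj_r]; rfl
  refine ⟨z, ?_⟩
  rw [act, ← hx', ← hx, ArrowGroupoid.mul_assoc _ _ _ hc (ArrowGroupoid.s_inv τ),
    ArrowGroupoid.inv_mul_self, ← hs, ArrowGroupoid.mul_s_self]

/-- A chosen point of `E` above `γ`. -/
noncomputable def lift (γ : G) : E := Function.surjInv T.isOpenQuotientMap_proj.surjective γ

theorem proj_lift (γ : G) : T.proj (T.lift γ) = γ := Function.surjInv_eq _ γ

/-- The points of `E` above `γ`. -/
abbrev Above (γ : G) : Type _ := {σ : E // T.proj σ = γ}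

/-- The open support `{γ | f(γ) ≠ 0}`, in `G`, of a section given as a function on `E`. -/
def openSupport (f : E → ℂ) : Set G := T.proj '' {σ | f σ ≠ 0}

/-- `C_c(G, E)`: continuous sections, with compact support in `G`, of the associated line bundle
`L = (ℂ × E)/𝕋`, viewed as functions on `E` with `f(zσ) = f(σ) z̄`. -/
structure CcSection where
  toFun : E → ℂ
  equivariant : ∀ z σ, toFun (T.act z σ) = toFun σ * conj (z : ℂ)
  continuous : Continuous toFun
  compactSupport : IsCompact (closure (T.openSupport toFun))

/-- The equivariant functions on the `𝕋`-torsor above `γ`. -/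
def lineFiberSubmodule (γ : G) : Submodule ℂ (T.Above γ → ℂ) where
  carrier := {φ | ∀ (z : Circle) (σ : T.Above γ),
    φ ⟨T.act z σ, (T.proj_act z σ).trans σ.2⟩ = φ σ * conj (z : ℂ)}
  add_mem' := by
    intro φ ψ hφ hψ z σ
    simp only [Pi.add_apply, hφ z σ, hψ z σ, add_mul]
  zero_mem' := by intro z σ; simp
  smul_mem' := by
    intro c φ hφ z σ
    simp only [Pi.smul_apply, hφ z σ, smul_eq_mul, mul_assoc]

/-- The fibre `L_γ` of the associated line bundle. -/
def LineFiber (γ : G) : Type _ := T.lineFiberSubmodule γ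

noncomputable instance (γ : G) : AddCommGroup (T.LineFiber γ) :=
  inferInstanceAs (AddCommGroup (T.lineFiberSubmodule γ))

noncomputable instance (γ : G) : Module ℂ (T.LineFiber γ) :=
  inferInstanceAs (Module ℂ (T.lineFiberSubmodule γ))

/-- The value of `φ ∈ L_γ` at `σ` above `γ`, as a linear functional of `φ`. -/
def evalAt {γ : G} (σ : T.Above γ) : T.LineFiber γ →ₗ[ℂ] ℂ :=
  (LinearMap.proj σ).comp (T.lineFiberSubmodule γ).subtype

theorem evalAt_act {γ : G} (z : Circle) (σ : T.Above γ) (φ : T.LineFiber γ) :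
    T.evalAt ⟨T.act z σ, (T.proj_act z σ).trans σ.2⟩ φ = T.evalAt σ φ * conj (z : ℂ) :=
  φ.2 z σ

theorem lineFiber_ext {γ : G} {φ ψ : T.LineFiber γ} (h : ∀ σ, T.evalAt σ φ = T.evalAt σ ψ) :
    φ = ψ :=
  Subtype.ext (funext h)

/-- The element of `L_γ` with prescribed values. -/
def mkFiber {γ : G} (φ : T.Above γ → ℂ) (h : ∀ (z : Circle) (σ : T.Above γ),
    φ ⟨T.act z σ, (T.proj_act z σ).trans σ.2⟩ = φ σ * conj (z : ℂ)) : T.LineFiber γ :=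
  ⟨φ, h⟩

/-- The chosen point above `γ`. -/
noncomputable def base (γ : G) : T.Above γ := ⟨T.lift γ, T.proj_lift γ⟩

theorem norm_evalAt {γ : G} (σ τ : T.Above γ) (φ : T.LineFiber γ) :
    ‖T.evalAt σ φ‖ = ‖T.evalAt τ φ‖ := by
  obtain ⟨z, hz⟩ := T.exists_act_eq (σ.2.trans τ.2.symm)
  have h : σ = ⟨T.act z τ, (T.proj_act z τ).trans τ.2⟩ := Subtype.ext hz
  rw [h, T.evalAt_act, norm_mul, RCLike.norm_conj, Circle.norm_coe, mul_one]

theorem eq_zero_of_evalAt {γ : G} (τ : T.Above γ) (φ : T.LineFiber γ) (h : T.evalAt τ φ = 0) :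
    φ = 0 := by
  apply T.lineFiber_ext
  intro σ
  rw [map_zero, ← norm_eq_zero, T.norm_evalAt σ τ, h, norm_zero]

/-- The inner product of `L_γ`: `⟨φ, ψ⟩ = conj φ(σ) ψ(σ)` for any `σ` above `γ`. -/
@[reducible] noncomputable def fiberCore (γ : G) : InnerProductSpace.Core ℂ (T.LineFiber γ) where
  inner φ ψ := conj (T.evalAt (T.base γ) φ) * T.evalAt (T.base γ) ψ
  conj_inner_symm φ ψ := by simp [mul_comm]
  re_inner_nonneg φ := by
    rw [← Complex.normSq_eq_conj_mul_self]
    simpa using Complex.normSq_nonneg _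
  add_left φ ψ χ := by simp [add_mul]
  smul_left φ ψ c := by simp [mul_assoc]
  definite φ h := by
    apply T.eq_zero_of_evalAt (T.base γ)
    simpa using h

noncomputable instance (γ : G) : NormedAddCommGroup (T.LineFiber γ) :=
  (T.fiberCore γ).toNormedAddCommGroup

noncomputable instance (γ : G) : InnerProductSpace ℂ (T.LineFiber γ) :=
  InnerProductSpace.ofCore (T.fiberCore γ).toCore

theorem norm_eq_evalAt {γ : G} (σ : T.Above γ) (φ : T.LineFiber γ) : ‖φ‖ = ‖T.evalAt σ φ‖ := by
  rw [T.norm_evalAt σ (T.base γ)]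
  have h : ‖φ‖ ^ 2 = ‖T.evalAt (T.base γ) φ‖ ^ 2 := by
    rw [@norm_sq_eq_re_inner ℂ]
    change RCLike.re (conj (T.evalAt (T.base γ) φ) * T.evalAt (T.base γ) φ) = _
    rw [← Complex.normSq_eq_conj_mul_self, Complex.normSq_eq_norm_sq]
    exact RCLike.ofReal_re (K := ℂ) _
  exact (sq_eq_sq₀ (norm_nonneg _) (norm_nonneg _)).1 h

instance (γ : G) : CompleteSpace (T.LineFiber γ) := by
  have h : Function.Injective (T.evalAt (T.base γ)) := by
    rw [injective_iff_map_eq_zero]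
    exact fun φ hφ => T.eq_zero_of_evalAt _ φ hφ
  have : FiniteDimensional ℂ (T.LineFiber γ) := FiniteDimensional.of_injective _ h
  exact FiniteDimensional.complete ℂ _

/-- `H_x = L²(G_x, L_x)`: square-summable sections of the line bundle over the source fibre
`G_x = s⁻¹(x)`, with its counting measure. -/
abbrev H (x : unitSpace G) : Type _ := lp (fun γ : {γ : G // src γ = x} => T.LineFiber γ.1) 2

/-- The value `ξ(σ)` of `ξ ∈ H_x` at `σ` with source `x`. -/
noncomputable def value {x : unitSpace G} (ξ : T.H x) (σ : E) (hσ : src (T.proj σ) = x) : ℂ :=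
  T.evalAt ⟨σ, rfl⟩ (ξ ⟨T.proj σ, hσ⟩)

end Basic

section Rep

variable {G E : Type*} [TopologicalSpace G] [TopologicalGroupoid G]
  [TopologicalSpace E] [TopologicalGroupoid E] {T : Twist G E}

theorem s_eq_of_src (T : Twist G E) {σ τ : E} (h : src (T.proj σ) = src (T.proj τ)) :
    ArrowGroupoid.s σ = ArrowGroupoid.s τ := by
  have h1 : ∀ ρ : E, ArrowGroupoid.s ρ = T.incl (1, src (T.proj ρ)) := by
    intro ρ
    have h2 := T.incl_one_rng (ArrowGroupoid.inv ρ)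
    rw [ArrowGroupoid.r_inv] at h2
    rw [← h2]
    congr 2
    apply Subtype.ext
    change ArrowGroupoid.r _ = ArrowGroupoid.s _
    rw [← T.proj_r, ArrowGroupoid.r_inv, T.proj_s]
  rw [h1, h1, h]

theorem proj_inv (T : Twist G E) (σ : E) :
    T.proj (ArrowGroupoid.inv σ) = ArrowGroupoid.inv (T.proj σ) := by
  apply mul_right_cancel' (c := T.proj σ)
  · rw [← T.proj_s, ArrowGroupoid.s_inv, T.proj_r]
  · rw [ArrowGroupoid.s_inv]
  · rw [← T.proj_mul _ _ (ArrowGroupoid.s_inv σ), ArrowGroupoid.inv_mul_self,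
      ArrowGroupoid.inv_mul_self, T.proj_s]

namespace CcSection

theorem norm_eq (f : T.CcSection) {σ τ : E} (h : T.proj σ = T.proj τ) :
    ‖f.toFun σ‖ = ‖f.toFun τ‖ := by
  obtain ⟨z, rfl⟩ := T.exists_act_eq h
  rw [f.equivariant, norm_mul, RCLike.norm_conj, Circle.norm_coe, mul_one]

theorem exists_norm_le (f : T.CcSection) : ∃ M : ℝ, 0 ≤ M ∧ ∀ σ, ‖f.toFun σ‖ ≤ M := by
  have h1 : (fun γ => ‖f.toFun (T.lift γ)‖) ∘ T.proj = fun σ => ‖f.toFun σ‖ :=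
    funext fun σ => f.norm_eq (T.proj_lift _)
  have h2 : Continuous fun γ => ‖f.toFun (T.lift γ)‖ := by
    rw [T.isOpenQuotientMap_proj.isQuotientMap.continuous_iff, h1]
    exact f.continuous.norm
  obtain ⟨M, hM⟩ := (f.compactSupport.image h2).bddAbove
  refine ⟨max M 0, le_max_right _ _, fun σ => ?_⟩
  by_cases h : f.toFun σ = 0
  · rw [h, norm_zero]; exact le_max_right _ _
  · refine le_trans ?_ (le_max_left _ _)
    rw [f.norm_eq (T.proj_lift (T.proj σ)).symm]
    exact hM ⟨T.proj σ, subset_closure ⟨σ, h, rfl⟩, rfl⟩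

/-- The coefficient `f(σ τ⁻¹)`. -/
def coeff (f : T.CcSection) (σ τ : E) : ℂ :=
  f.toFun (ArrowGroupoid.mul σ (ArrowGroupoid.inv τ))

theorem coeff_act (f : T.CcSection) (z : Circle) {σ τ : E}
    (h : src (T.proj σ) = src (T.proj τ)) :
    f.coeff (T.act z σ) τ = f.coeff σ τ * conj (z : ℂ) := by
  rw [coeff, ← T.act_mul, f.equivariant, coeff]
  rw [ArrowGroupoid.r_inv]
  exact s_eq_of_src T h

theorem mem_support_of_coeff (f : T.CcSection) {σ τ : E}
    (h : src (T.proj σ) = src (T.proj τ)) (hf : f.coeff σ τ ≠ 0) :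
    ArrowGroupoid.mul (T.proj σ) (ArrowGroupoid.inv (T.proj τ)) ∈ closure (T.openSupport f.toFun) := by
  apply subset_closure
  refine ⟨_, hf, ?_⟩
  rw [T.proj_mul, proj_inv]
  rw [ArrowGroupoid.r_inv]
  exact s_eq_of_src T h

/-- The sum defining `(π_x(f) ξ)(σ)`, over the fibre `G_x` with its counting measure; the summand
does not depend on the choice of the point `τ` above `γ`. -/
noncomputable def convSum (f : T.CcSection) {x : unitSpace G} (ξ : T.H x) (σ : E) : ℂ :=
  ∑' γ : {γ : G // src γ = x}, f.coeff σ (T.lift γ.1) * T.evalAt (T.base γ.1) (ξ γ)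

/-- `π_x(f) ξ` at `γ ∈ G_x`, as an element of `L_γ`. -/
noncomputable def convFiber (f : T.CcSection) {x : unitSpace G} (ξ : T.H x)
    (γ : {γ : G // src γ = x}) : T.LineFiber γ.1 :=
  T.mkFiber (fun σ => f.convSum ξ σ.1) fun z σ => by
    simp only [convSum]
    rw [← tsum_mul_right]
    refine tsum_congr fun γ' => ?_
    rw [f.coeff_act]
    · ring
    · rw [σ.2, T.proj_lift, γ.2, γ'.2]

open Classical in
theorem exists_rows [IsEtale G] (f : T.CcSection) : ∃ n : ℕ, ∀ x : unitSpace G,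
    ∃ R : {γ : G // src γ = x} → Finset {γ : G // src γ = x},
      (∀ γ, (R γ).card ≤ n) ∧
      (∀ (γ' : {γ : G // src γ = x}) (t : Finset {γ : G // src γ = x}),
        (∀ γ ∈ t, γ' ∈ R γ) → t.card ≤ n) ∧
      ∀ γ γ', f.coeff (T.lift γ.1) (T.lift γ'.1) ≠ 0 → γ' ∈ R γ := by
  obtain ⟨n₁, h₁⟩ := exists_card_le (isLocalHomeomorph_both G).1 f.compactSupport
  obtain ⟨n₂, h₂⟩ := exists_card_le (isLocalHomeomorph_both G).2 f.compactSupport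
  refine ⟨max n₁ n₂, fun x => ?_⟩
  set K := closure (T.openSupport f.toFun) with hK
  let q : {γ : G // src γ = x} → {γ : G // src γ = x} → G :=
    fun γ γ' => ArrowGroupoid.mul γ.1 (ArrowGroupoid.inv γ'.1)
  have hcomp : ∀ γ γ' : {γ : G // src γ = x},
      ArrowGroupoid.s γ.1 = ArrowGroupoid.r (ArrowGroupoid.inv γ'.1) := by
    intro γ γ'
    rw [ArrowGroupoid.r_inv]
    exact congrArg Subtype.val (γ.2.trans γ'.2.symm)
  have hq1 : ∀ γ, Function.Injective (q γ) := by
    intro γ a b hab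
    have h := mul_left_cancel' (hcomp γ a) (hcomp γ b) hab
    apply Subtype.ext
    rw [← inv_inv' a.1, h, inv_inv']
  have hq2 : ∀ γ', Function.Injective fun γ => q γ γ' := by
    intro γ' a b hab
    exact Subtype.ext (mul_right_cancel' (hcomp a γ') (hcomp b γ') hab)
  have hr : ∀ γ (t : Finset {γ : G // src γ = x}), (∀ γ' ∈ t, q γ γ' ∈ K) → t.card ≤ n₁ := by
    intro γ t ht
    rw [← Finset.card_image_of_injective t (hq1 γ)]
    apply h₁ (rng γ.1)
    intro a ha
    obtain ⟨γ', hγ', rfl⟩ := Finset.mem_image.1 ha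
    exact ⟨ht γ' hγ', Subtype.ext (ArrowGroupoid.r_mul _ _ (hcomp γ γ'))⟩
  have hfin : ∀ γ, {γ' | q γ γ' ∈ K}.Finite := by
    intro γ
    by_contra hinf
    obtain ⟨t, ht1, ht2⟩ := (show {γ' | q γ γ' ∈ K}.Infinite from hinf).exists_subset_card_eq (n₁ + 1)
    have := hr γ t fun γ' h => ht1 h
    omega
  refine ⟨fun γ => (hfin γ).toFinset, fun γ => ?_, fun γ' t ht => ?_, fun γ γ' h => ?_⟩
  · refine (hr γ _ fun γ' h => ?_).trans (le_max_left _ _)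
    simpa using h
  · refine le_trans ?_ (le_max_right _ _)
    rw [← Finset.card_image_of_injective t (hq2 γ')]
    apply h₂ (rng γ'.1)
    intro a ha
    obtain ⟨γ, hγ, rfl⟩ := Finset.mem_image.1 ha
    refine ⟨by simpa using ht γ hγ, Subtype.ext ?_⟩
    exact (ArrowGroupoid.s_mul _ _ (hcomp γ γ')).trans (ArrowGroupoid.s_inv _)
  · have := f.mem_support_of_coeff (by rw [T.proj_lift, T.proj_lift, γ.2, γ'.2]) h
    rw [T.proj_lift, T.proj_lift] at this
    simpa using this

theorem summable_normSq {x : unitSpace G} (ξ : T.H x) : Summable fun γ => ‖ξ γ‖ ^ 2 := by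
  have h := (memℓp_gen_iff (p := 2) (by norm_num)).1 (lp.memℓp ξ)
  simpa using h

theorem tsum_normSq {x : unitSpace G} (ξ : T.H x) : ∑' γ, ‖ξ γ‖ ^ 2 = ‖ξ‖ ^ 2 := by
  have h := lp.norm_rpow_eq_tsum (p := 2) (by norm_num) ξ
  simpa using h.symm

/-- The operators `π_x(f)` are well defined and bounded, uniformly in `x`. -/
theorem exists_bound [IsEtale G] (f : T.CcSection) : ∃ C : ℝ, 0 ≤ C ∧
    ∀ (x : unitSpace G),
      (∀ (ξ : T.H x) (γ : {γ : G // src γ = x}), Summable fun γ' : {γ : G // src γ = x} =>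
        f.coeff (T.lift γ.1) (T.lift γ'.1) * T.evalAt (T.base γ'.1) (ξ γ')) ∧
      ∀ (ξ : T.H x) (t : Finset {γ : G // src γ = x}),
        ∑ γ ∈ t, ‖f.convFiber ξ γ‖ ^ 2 ≤ (C * ‖ξ‖) ^ 2 := by
  obtain ⟨M, hM0, hM⟩ := f.exists_norm_le
  obtain ⟨n, hn⟩ := f.exists_rows
  refine ⟨n * M, by positivity, fun x => ?_⟩
  obtain ⟨R, hR1, hR2, hR3⟩ := hn x
  have hz : ∀ (ξ : T.H x) (γ γ' : {γ : G // src γ = x}), γ' ∉ R γ →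
      f.coeff (T.lift γ.1) (T.lift γ'.1) * T.evalAt (T.base γ'.1) (ξ γ') = 0 := by
    intro ξ γ γ' h
    rw [not_imp_comm.1 (hR3 γ γ') h, zero_mul]
  refine ⟨fun ξ γ => summable_of_ne_finset_zero (s := R γ) fun γ' h => hz ξ γ γ' h, fun ξ t => ?_⟩
  rw [mul_pow, ← tsum_normSq]
  apply sparse_bound R n hR1 hR2 (fun γ => ‖ξ γ‖) (fun γ => ‖f.convFiber ξ γ‖) M
    (fun _ => norm_nonneg _) _ (summable_normSq ξ)
  intro γ
  rw [T.norm_eq_evalAt (T.base γ.1)]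
  change ‖∑' γ' : {γ : G // src γ = x},
    f.coeff (T.lift γ.1) (T.lift γ'.1) * T.evalAt (T.base γ'.1) (ξ γ')‖ ≤ _
  rw [tsum_eq_sum (s := R γ) fun γ' h => hz ξ γ γ' h, Finset.mul_sum]
  refine (norm_sum_le _ _).trans (Finset.sum_le_sum fun γ' _ => ?_)
  rw [norm_mul, T.norm_eq_evalAt (T.base γ'.1)]
  exact mul_le_mul_of_nonneg_right (hM _) (norm_nonneg _)

theorem memℓp_convFiber [IsEtale G] (f : T.CcSection) {x : unitSpace G} (ξ : T.H x) :
    Memℓp (f.convFiber ξ) 2 := by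
  obtain ⟨C, -, hC⟩ := f.exists_bound
  apply memℓp_gen' (C := (C * ‖ξ‖) ^ 2)
  intro t
  simpa using (hC x).2 ξ t

/-- `(π_x(f) ξ)(σ) = ∑_{τ̇ ∈ G_x} f(σ τ⁻¹) ξ(τ)`, as a linear map. -/
noncomputable def regLinear [IsEtale G] (f : T.CcSection) (x : unitSpace G) :
    T.H x →ₗ[ℂ] T.H x where
  toFun ξ := ⟨f.convFiber ξ, f.memℓp_convFiber ξ⟩
  map_add' ξ η := by
    obtain ⟨C, -, hC⟩ := f.exists_bound
    ext γ
    rw [lp.coeFn_add, Pi.add_apply]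
    rw [← sub_eq_zero]
    apply T.eq_zero_of_evalAt (T.base γ.1)
    rw [map_sub, map_add, sub_eq_zero]
    change f.convSum (ξ + η) (T.lift γ.1) = f.convSum ξ (T.lift γ.1) + f.convSum η (T.lift γ.1)
    rw [convSum, convSum, convSum, ← ((hC x).1 ξ γ).tsum_add ((hC x).1 η γ)]
    refine tsum_congr fun γ' => ?_
    rw [lp.coeFn_add, Pi.add_apply, map_add, mul_add]
  map_smul' c ξ := by
    ext γ
    rw [lp.coeFn_smul, Pi.smul_apply]
    rw [← sub_eq_zero]
    apply T.eq_zero_of_evalAt (T.base γ.1)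
    rw [map_sub, map_smul, sub_eq_zero]
    change f.convSum (c • ξ) (T.lift γ.1) = c • f.convSum ξ (T.lift γ.1)
    rw [convSum, convSum, smul_eq_mul, ← tsum_mul_left]
    refine tsum_congr fun γ' => ?_
    rw [lp.coeFn_smul, Pi.smul_apply, map_smul, smul_eq_mul]
    ring

theorem regLinear_bound [IsEtale G] (f : T.CcSection) : ∃ C : ℝ, 0 ≤ C ∧
    ∀ (x : unitSpace G) (ξ : T.H x), ‖f.regLinear x ξ‖ ≤ C * ‖ξ‖ := by
  obtain ⟨C, hC0, hC⟩ := f.exists_bound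
  refine ⟨C, hC0, fun x ξ => ?_⟩
  apply lp.norm_le_of_forall_sum_le (p := 2) (by norm_num) (by positivity)
  intro t
  have h : ∑ γ ∈ t, ‖(f.regLinear x ξ) γ‖ ^ 2 ≤ (C * ‖ξ‖) ^ 2 := (hC x).2 ξ t
  simpa using h

/-- The bounded operator `π_x(f)` on `H_x`. -/
noncomputable def regRep [IsEtale G] (f : T.CcSection) (x : unitSpace G) : T.H x →L[ℂ] T.H x :=
  (f.regLinear x).mkContinuousOfExistsBound
    (f.regLinear_bound.imp fun _ h => h.2 x)

end CcSection

variable (T) in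
/-- The C⋆-algebra of bounded families of operators `(a_x)` on the Hilbert spaces `H_x`, with
coordinatewise operations and norm `sup_x ‖a_x‖`. -/
def BoundedFamilies : Type _ := lp (fun x : unitSpace G => T.H x →L[ℂ] T.H x) ∞

noncomputable instance : NonUnitalCStarAlgebra T.BoundedFamilies :=
  inferInstanceAs (NonUnitalCStarAlgebra (lp (fun x : unitSpace G => T.H x →L[ℂ] T.H x) ∞))

namespace BoundedFamilies

/-- The operator `a_x`. -/
def component (a : T.BoundedFamilies) (x : unitSpace G) : T.H x →L[ℂ] T.H x := a.1 x

/-- A uniformly bounded family of operators as an element of the C⋆-algebra. -/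
def mk (a : ∀ x : unitSpace G, T.H x →L[ℂ] T.H x) (h : ∃ C : ℝ, ∀ x, ‖a x‖ ≤ C) :
    T.BoundedFamilies :=
  ⟨a, memℓp_infty (h.imp fun _ hC => by rintro _ ⟨x, rfl⟩; exact hC x)⟩

theorem ext {a b : T.BoundedFamilies} (h : ∀ x, a.component x = b.component x) : a = b :=
  Subtype.ext (funext h)

theorem component_mk (a : ∀ x : unitSpace G, T.H x →L[ℂ] T.H x) (h : ∃ C : ℝ, ∀ x, ‖a x‖ ≤ C)
    (x : unitSpace G) : (mk a h).component x = a x := rfl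

theorem component_add (a b : T.BoundedFamilies) (x : unitSpace G) :
    (a + b).component x = a.component x + b.component x := rfl

theorem component_smul (c : ℂ) (a : T.BoundedFamilies) (x : unitSpace G) :
    (c • a).component x = c • a.component x := rfl

theorem component_zero (x : unitSpace G) : (0 : T.BoundedFamilies).component x = 0 := rfl

theorem component_mul (a b : T.BoundedFamilies) (x : unitSpace G) :
    (a * b).component x = a.component x * b.component x := rfl

theorem component_star (a : T.BoundedFamilies) (x : unitSpace G) :
    (star a).component x = star (a.component x) := rfl

theorem norm_component_le (a : T.BoundedFamilies) (x : unitSpace G) : ‖a.component x‖ ≤ ‖a‖ :=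
  lp.norm_apply_le_norm (by simp) (show lp (fun x : unitSpace G => T.H x →L[ℂ] T.H x) ∞ from a) x

theorem norm_le (a : T.BoundedFamilies) {C : ℝ} (hC : 0 ≤ C) (h : ∀ x, ‖a.component x‖ ≤ C) :
    ‖a‖ ≤ C :=
  lp.norm_le_of_forall_le (f := (show lp (fun x : unitSpace G => T.H x →L[ℂ] T.H x) ∞ from a)) hC h

end BoundedFamilies

/-- The family `π(f) = (π_x(f))_x`; its norm `sup_x ‖π_x(f)‖` is the reduced norm of `f`. -/
noncomputable def CcSection.reg [IsEtale G] (f : T.CcSection) : T.BoundedFamilies :=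
  BoundedFamilies.mk f.regRep <| f.regLinear_bound.imp fun _ hC x =>
    ContinuousLinearMap.opNorm_le_bound _ hC.1 (hC.2 x)

variable (T) in
/-- The reduced C⋆-algebra `C⋆_red(G, E)`: the completion of `C_c(G, E)` for the reduced norm,
realised as the norm closure of the ⋆-algebra generated by `π(C_c(G, E))`. Since
`π(f) π(g) = π(f * g)` and `π(f)⋆ = π(f*)` for the convolution product and involution of
`C_c(G, E)`, this is the norm closure of `π(C_c(G, E))`. -/
noncomputable def reducedCStarAlgebra [IsEtale G] :
    NonUnitalStarSubalgebra ℂ T.BoundedFamilies :=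
  (NonUnitalStarAlgebra.adjoin ℂ (Set.range (CcSection.reg (T := T)))).topologicalClosure

variable (T) in
/-- The unit vector of `L_x` for a unit `x`: `(z, x) ↦ z̄`. -/
noncomputable def unitFiber (x : unitSpace G) : T.LineFiber (x : G) :=
  T.mkFiber (fun σ => conj
      ((Classical.choose (T.exact σ.1 (σ.2.symm ▸ x.2)) : Circle) : ℂ)) fun z σ => by
    have h1 := Classical.choose_spec (T.exact σ.1 (σ.2.symm ▸ x.2))
    have h2 := Classical.choose_spec (T.exact (T.act z σ.1)
      (((T.proj_act z σ.1).trans σ.2).symm ▸ x.2))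
    obtain ⟨y, hy⟩ := h1
    obtain ⟨y', hy'⟩ := h2
    rw [← map_mul, ← Circle.coe_mul]
    congr 2
    have h3 := congrArg (T.act z) hy
    rw [T.act_incl, hy'] at h3
    have h4 := congrArg Prod.fst (T.isEmbedding_incl.injective h3)
    rw [mul_comm]
    exact h4

theorem evalAt_unitFiber (x : unitSpace G) (z : Circle) :
    T.evalAt ⟨T.incl (z, x), T.proj_incl z x⟩ (T.unitFiber x) = conj (z : ℂ) := by
  have h : T.proj (T.incl (z, x)) ∈ unitSpace G := by rw [T.proj_incl]; exact x.2
  obtain ⟨y, hy⟩ := Classical.choose_spec (T.exact _ h)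
  have h1 : z = Classical.choose (T.exact _ h) :=
    congrArg Prod.fst (T.isEmbedding_incl.injective hy)
  exact congrArg (fun w : Circle => conj (w : ℂ)) h1.symm

variable (T) in
open Classical in
/-- `ε_x ∈ H_x`: the section equal to `z̄` at `(z, x)` and to `0` off `𝕋 × {x}`. -/
noncomputable def unitVector (x : unitSpace G) : T.H x :=
  lp.single 2 (⟨(x : G), Subtype.ext (by
    change ArrowGroupoid.s (x : G) = x
    have h : ArrowGroupoid.r (x : G) = x := x.2
    rw [← h, ArrowGroupoid.s_r])⟩ : {γ : G // src γ = x}) (T.unitFiber x)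

/-- The section of the line bundle `L`, as a function on `E`, given by an element `a` of the reduced
C⋆-algebra: `a(σ) = (a_x ε_x)(σ)` with `x = s(σ)`. It extends `π(f) ↦ f`. -/
noncomputable def toSection (a : T.BoundedFamilies) (σ : E) : ℂ :=
  T.value (a.component (src (T.proj σ)) (T.unitVector (src (T.proj σ)))) σ rfl

/-- The open support `supp'(a) ⊆ G`. -/
def supp' (a : T.BoundedFamilies) : Set G := T.openSupport (toSection a)

/-! ### The subalgebra `C₀(G⁽⁰⁾)` -/

theorem norm_apply_le (h : ZeroAtInftyContinuousMap (unitSpace G) ℂ) (x : unitSpace G) :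
    ‖h x‖ ≤ ‖h‖ := by
  rw [← ZeroAtInftyContinuousMap.norm_toBCF_eq_norm]
  exact h.toBCF.norm_coe_le_norm x

theorem norm_smul_fiber_le (h : ZeroAtInftyContinuousMap (unitSpace G) ℂ) {x : unitSpace G}
    (ξ : T.H x) (γ : {γ : G // src γ = x}) :
    ‖h (rng γ.1) • ξ γ‖ ≤ ‖(((‖h‖ : ℝ) : ℂ) • ξ) γ‖ := by
  rw [lp.coeFn_smul, Pi.smul_apply, norm_smul, norm_smul]
  apply mul_le_mul_of_nonneg_right _ (norm_nonneg _)
  simpa using norm_apply_le h (rng γ.1)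

variable (T) in
/-- `h ∈ C₀(G⁽⁰⁾)` acting on `H_x` by `(hξ)(σ) = h(r(σ)) ξ(σ)`. -/
noncomputable def mulOp (h : ZeroAtInftyContinuousMap (unitSpace G) ℂ) (x : unitSpace G) :
    T.H x →L[ℂ] T.H x :=
  LinearMap.mkContinuous
    { toFun := fun ξ => ⟨fun γ => h (rng γ.1) • ξ γ,
        (lp.memℓp (((‖h‖ : ℝ) : ℂ) • ξ)).mono' (norm_smul_fiber_le h ξ)⟩
      map_add' := fun ξ η => by
        ext γ
        exact smul_add _ _ _
      map_smul' := fun c ξ => by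
        ext γ
        exact smul_comm (h (rng γ.1)) c (ξ γ) }
    ‖h‖ (fun ξ => by
      refine (lp.norm_mono (p := 2) (by norm_num) (norm_smul_fiber_le h ξ)).trans ?_
      rw [norm_smul]
      simp)

theorem mulOp_apply (h : ZeroAtInftyContinuousMap (unitSpace G) ℂ) {x : unitSpace G}
    (ξ : T.H x) (γ : {γ : G // src γ = x}) : T.mulOp h x ξ γ = h (rng γ.1) • ξ γ := rfl

theorem norm_mulOp_le (h : ZeroAtInftyContinuousMap (unitSpace G) ℂ) (x : unitSpace G) :
    ‖T.mulOp h x‖ ≤ ‖h‖ :=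
  LinearMap.mkContinuous_norm_le _ (norm_nonneg _) _

theorem mulOp_ext {x : unitSpace G} {a b : T.H x →L[ℂ] T.H x} (h : ∀ ξ γ, a ξ γ = b ξ γ) :
    a = b :=
  ContinuousLinearMap.ext fun ξ => lp.ext (funext (h ξ))

theorem mulOp_star (h : ZeroAtInftyContinuousMap (unitSpace G) ℂ) (x : unitSpace G) :
    T.mulOp (star h) x = star (T.mulOp h x) := by
  rw [ContinuousLinearMap.star_eq_adjoint, ContinuousLinearMap.eq_adjoint_iff]
  intro ξ η
  rw [lp.inner_eq_tsum, lp.inner_eq_tsum]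
  refine tsum_congr fun γ => ?_
  rw [mulOp_apply, mulOp_apply, inner_smul_left, inner_smul_right]
  simp

variable (T) in
/-- The embedding of `C₀(G⁽⁰⁾)`: the function `h` corresponds to the section of `L` equal to
`h(x) z̄` at `(z, x) ∈ 𝕋 × G⁽⁰⁾` and to `0` off `𝕋 × G⁽⁰⁾`, whose convolution product with a
section `ξ` is `(h ∘ r) ξ`. -/
noncomputable def unitHom :
    ZeroAtInftyContinuousMap (unitSpace G) ℂ →⋆ₙₐ[ℂ] T.BoundedFamilies where
  toFun h := BoundedFamilies.mk (T.mulOp h) ⟨‖h‖, norm_mulOp_le h⟩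
  map_smul' c h := BoundedFamilies.ext fun _ => mulOp_ext fun ξ γ =>
    mul_smul c (h (rng γ.1)) (ξ γ)
  map_zero' := BoundedFamilies.ext fun _ => mulOp_ext fun ξ γ => zero_smul ℂ (ξ γ)
  map_add' h k := BoundedFamilies.ext fun _ => mulOp_ext fun ξ γ =>
    add_smul (h (rng γ.1)) (k (rng γ.1)) (ξ γ)
  map_mul' h k := BoundedFamilies.ext fun _ => mulOp_ext fun ξ γ =>
    mul_smul (h (rng γ.1)) (k (rng γ.1)) (ξ γ)
  map_star' h := BoundedFamilies.ext fun x => mulOp_star h x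

variable (T) in
/-- The subalgebra `B = C₀(G⁽⁰⁾)`. -/
noncomputable def unitSubalgebra : NonUnitalStarSubalgebra ℂ T.BoundedFamilies :=
  NonUnitalStarAlgHom.range T.unitHom

end Rep

end Twist

/-- `B` is a masa (maximal abelian self-adjoint subalgebra) in `A`. -/
def IsMasa {M : Type*} [NonUnitalCStarAlgebra M] (A B : NonUnitalStarSubalgebra ℂ M) : Prop :=
  Maximal (fun C : NonUnitalStarSubalgebra ℂ M => C ≤ A ∧ ∀ a ∈ C, ∀ b ∈ C, a * b = b * a) B

end TwistedGroupoid

/-!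
Let `A` be the reduced C⋆-algebra of the twist `E → G` and `B = C₀(G⁽⁰⁾)`.

*Matrix coefficients.* The operators `π_x(f)` commute with the right translations
`H_{r(τ)} → H_{s(τ)}`, `ξ ↦ ξ(· τ⁻¹)`. This property (`IsInvariant`) passes to products, linear
combinations and norm limits, so every `a ∈ A` has it. Since the basis vector of `H_x` at `ρ` is the
translate by `ρ` of the unit vector at `r(ρ)`, the coefficient of `a_x` at `(σ, ρ)` is `a(σ ρ⁻¹)`
(`IsInvariant.value_basisVec`): the operator `a` is determined by its section.

*The commutant of `B`.* Applying `ah = ha` to the unit vector at `s(σ)` gives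
`h(s(σ)) a(σ) = h(r(σ)) a(σ)`, and `C₀(G⁽⁰⁾)` separates points, so an element commuting with `B` has
its open support in the isotropy. Conversely `ah` and `ha` have coefficients `a(σ ρ⁻¹) h(r(ρ))` and
`h(r(σ)) a(σ ρ⁻¹)`, which agree if `a` is supported in the isotropy.

*Sections of elements of `A` are continuous and vanish at infinity*
(`isInvariant_and_hasC0Section`). Left multiplication by `π(f)` is convolution by `f`; after a
partition of unity `f` lives on an open set where the range map is injective, so that the convolution
sum has one term `f(ρ) b(ρ⁻¹ σ)`, and openness of `E → G` and of the range map gives continuity in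
`σ`. Hence the families `a` such that `a` and all `ab` have sections of this kind, for every `b` whose
section is of this kind, form an algebra containing each `π(f)` and `π(f)⋆ = π(f*)`. Sections being
bounded by the norm, the property passes to the closure.

*The masa property.* If `G` is essentially principal and `a ∈ A` commutes with `B`, then `supp'(a)`
is open and contained in the isotropy, hence in `G⁽⁰⁾`, and `a` is the element of `B` given by the
restriction of its section to `G⁽⁰⁾`. Conversely, if `γ` is interior to the isotropy and not a unit, a
section `f` supported near `γ` with `f(γ) ≠ 0` gives `π(f)` in the commutant of `B` but not in `B`,
whereas a masa is its own relative commutant (`IsMasa.mem_of_commute`). Such an `f` is the average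
over `𝕋` of a Urysohn function on `E` (`exists_ccSection`); `E` is Hausdorff because `𝕋 × G⁽⁰⁾` is
embedded in it, and locally compact because `𝕋` is compact.
-/

namespace TwistedGroupoid

open ArrowGroupoid (r s mul inv)

/-! ### Algebra in groupoids and in twists -/

section Algebra

variable {G : Type*} [TopologicalSpace G] [TopologicalGroupoid G]

theorem mul_mul_inv_cancel {a b : G} (h : s a = r b) : mul (mul a b) (inv b) = a := by
  rw [ArrowGroupoid.mul_assoc _ _ _ h (ArrowGroupoid.r_inv b).symm, ArrowGroupoid.mul_inv_self,
    ← h, ArrowGroupoid.mul_s_self]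

theorem mul_inv_mul_cancel {a b : G} (h : s a = s b) : mul (mul a (inv b)) b = a := by
  rw [ArrowGroupoid.mul_assoc _ _ _ (h.trans (ArrowGroupoid.r_inv b).symm)
    (ArrowGroupoid.s_inv b), ArrowGroupoid.inv_mul_self, ← h, ArrowGroupoid.mul_s_self]

theorem inv_mul_mul_cancel {a b : G} (h : s a = r b) : mul (inv a) (mul a b) = b := by
  rw [← ArrowGroupoid.mul_assoc _ _ _ (ArrowGroupoid.s_inv a) h, ArrowGroupoid.inv_mul_self,
    h, ArrowGroupoid.r_mul_self]

theorem mul_inv_mul_cancel_left {a b : G} (h : r a = r b) : mul a (mul (inv a) b) = b := by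
  rw [← ArrowGroupoid.mul_assoc _ _ _ (ArrowGroupoid.r_inv a).symm
    ((ArrowGroupoid.s_inv a).trans h), ArrowGroupoid.mul_inv_self, h, ArrowGroupoid.r_mul_self]

theorem inv_mul_rev {a b : G} (h : s a = r b) : inv (mul a b) = mul (inv b) (inv a) := by
  have hc : s (inv b) = r (inv a) := by rw [ArrowGroupoid.s_inv, ArrowGroupoid.r_inv, h]
  apply mul_right_cancel' (c := mul a b)
  · rw [ArrowGroupoid.s_inv]
  · rw [ArrowGroupoid.s_mul _ _ hc, ArrowGroupoid.s_inv, ArrowGroupoid.r_mul _ _ h]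
  · rw [ArrowGroupoid.inv_mul_self, ArrowGroupoid.s_mul _ _ h,
      ArrowGroupoid.mul_assoc _ _ _ hc (by rw [ArrowGroupoid.s_inv, ArrowGroupoid.r_mul _ _ h]),
      inv_mul_mul_cancel h, ArrowGroupoid.inv_mul_self]

theorem inv_mul_inv {a b : G} (h : s a = s b) : inv (mul a (inv b)) = mul b (inv a) := by
  rw [inv_mul_rev (h.trans (ArrowGroupoid.r_inv b).symm), inv_inv']

theorem mul_inv_mul_mul {a b c : G} (hac : s a = s c) (hbc : s b = r c) :
    mul a (inv (mul b c)) = mul (mul a (inv c)) (inv b) := by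
  rw [inv_mul_rev hbc, ArrowGroupoid.mul_assoc _ _ _ (hac.trans (ArrowGroupoid.r_inv c).symm)]
  rw [ArrowGroupoid.s_inv, ArrowGroupoid.r_inv, hbc]

theorem inv_of_mem_unitSpace {a : G} (h : a ∈ unitSpace G) : inv a = a := by
  have h1 : r a = a := h
  have h2 : s a = a := by rw [← h1, ArrowGroupoid.s_r]
  have h3 := ArrowGroupoid.mul_s_self (inv a)
  rw [ArrowGroupoid.s_inv, h1, ArrowGroupoid.inv_mul_self, h2] at h3
  exact h3.symm

theorem s_of_mem_unitSpace {a : G} (h : a ∈ unitSpace G) : s a = a := by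
  have h1 : r a = a := h
  rw [← h1, ArrowGroupoid.s_r]

theorem rng_coe (x : unitSpace G) : rng (x : G) = x := Subtype.ext x.2

theorem src_coe (x : unitSpace G) : src (x : G) = x := Subtype.ext (s_of_mem_unitSpace x.2)

theorem rng_mul {a b : G} (h : src a = rng b) : rng (mul a b) = rng a :=
  Subtype.ext (ArrowGroupoid.r_mul _ _ (congrArg Subtype.val h))

theorem src_mul {a b : G} (h : src a = rng b) : src (mul a b) = src b :=
  Subtype.ext (ArrowGroupoid.s_mul _ _ (congrArg Subtype.val h))

theorem continuous_rng : Continuous (rng : G → unitSpace G) :=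
  TopologicalGroupoid.continuous_r.subtype_mk _

variable (G) in
theorem isClosed_unitSpace [T2Space G] : IsClosed (unitSpace G) :=
  isClosed_eq TopologicalGroupoid.continuous_r continuous_id

variable (G) in
theorem isOpen_unitSpace [IsEtale G] : IsOpen (unitSpace G) := by
  rw [isOpen_iff_mem_nhds]
  intro x hx
  obtain ⟨e, hxe, he⟩ := (isLocalHomeomorph_both G).1 x
  have hr : r x = x := hx
  have h1 : e.source ∈ nhds x := e.open_source.mem_nhds hxe
  have h2 : r ⁻¹' e.source ∈ nhds x :=
    TopologicalGroupoid.continuous_r.continuousAt.preimage_mem_nhds (by rwa [hr])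
  filter_upwards [h1, h2] with a ha1 ha2
  -- `a` and `r a` lie in a set on which the range map is injective, and have the same range
  apply e.injOn ha2 ha1
  rw [← he]
  exact Subtype.ext (ArrowGroupoid.r_r a)

theorem unitSpace_subset_isotropy : unitSpace G ⊆ isotropy G := fun a ha => by
  change r a = s a
  rw [s_of_mem_unitSpace ha]
  exact ha

end Algebra

namespace Twist

variable {G E : Type*} [TopologicalSpace G] [TopologicalGroupoid G]
  [TopologicalSpace E] [TopologicalGroupoid E] (T : Twist G E)

theorem rng_proj_eq {σ τ : E} (h : r σ = r τ) : rng (T.proj σ) = rng (T.proj τ) :=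
  Subtype.ext (by change r _ = r _; rw [← T.proj_r, ← T.proj_r, h])

theorem src_proj_eq {σ τ : E} (h : s σ = s τ) : src (T.proj σ) = src (T.proj τ) :=
  Subtype.ext (by change s _ = s _; rw [← T.proj_s, ← T.proj_s, h])

theorem src_proj_eq_rng_proj {σ τ : E} (h : s σ = r τ) : src (T.proj σ) = rng (T.proj τ) :=
  Subtype.ext (by change s _ = r _; rw [← T.proj_s, ← T.proj_r, h])

theorem r_eq_of_rng {σ τ : E} (h : rng (T.proj σ) = rng (T.proj τ)) : r σ = r τ := by
  rw [← T.incl_one_rng, ← T.incl_one_rng, h]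

theorem incl_one_src (σ : E) : T.incl (1, src (T.proj σ)) = s σ := by
  have h := T.incl_one_rng (inv σ)
  rwa [proj_inv, rng_inv, ArrowGroupoid.r_inv] at h

theorem s_eq_r_of_src_eq_rng {σ τ : E} (h : src (T.proj σ) = rng (T.proj τ)) : s σ = r τ := by
  rw [← T.incl_one_src, ← T.incl_one_rng, h]

theorem rng_proj_incl (z : Circle) (x : unitSpace G) : rng (T.proj (T.incl (z, x))) = x := by
  rw [T.proj_incl, rng_coe]

theorem src_proj_incl (z : Circle) (x : unitSpace G) : src (T.proj (T.incl (z, x))) = x := by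
  rw [T.proj_incl, src_coe]

theorem proj_mul_inv {σ τ : E} (h : s σ = s τ) :
    T.proj (mul σ (inv τ)) = mul (T.proj σ) (inv (T.proj τ)) := by
  rw [T.proj_mul _ _ (h.trans (ArrowGroupoid.r_inv τ).symm), proj_inv]

theorem act_one (σ : E) : T.act 1 σ = σ := by
  rw [act, T.incl_one_rng, ArrowGroupoid.r_mul_self]

theorem act_act (z w : Circle) (σ : E) : T.act z (T.act w σ) = T.act (z * w) σ := by
  rw [act, T.proj_act, act, act, ← ArrowGroupoid.mul_assoc, ← T.incl_mul]
  · rw [T.s_incl, T.r_incl]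
  · exact T.s_incl_rng w σ

/-- Centrality of the extension: `𝕋` also acts through the second factor of a product. -/
theorem mul_act (z : Circle) {σ τ : E} (h : s σ = r τ) :
    mul σ (T.act z τ) = T.act z (mul σ τ) := by
  have h1 : src (T.proj σ) = rng (T.proj τ) := T.src_proj_eq_rng_proj h
  rw [T.act_mul z σ τ h, act, ← ArrowGroupoid.mul_assoc, ← h1, ← T.central]
  · rfl
  · rw [T.r_incl, T.incl_one_rng, h]
  · exact T.s_incl_rng z τ

theorem inv_act (z : Circle) (σ : E) : inv (T.act z σ) = T.act z⁻¹ (inv σ) := by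
  apply mul_left_cancel' (c := T.act z σ)
  · rw [ArrowGroupoid.r_inv]
  · rw [T.r_act, T.s_act, ArrowGroupoid.r_inv]
  · rw [T.mul_act z⁻¹ (by rw [T.s_act, ArrowGroupoid.r_inv]),
      ← T.act_mul z _ _ (ArrowGroupoid.r_inv σ).symm, T.act_act, inv_mul_cancel, T.act_one,
      ArrowGroupoid.mul_inv_self, ArrowGroupoid.mul_inv_self, T.r_act]

theorem act_injective (σ : E) : Function.Injective fun z => T.act z σ := by
  intro z w h
  have hz : ∀ u : Circle, mul (T.act u σ) (inv σ) = T.incl (u, rng (T.proj σ)) := fun u =>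
    mul_mul_inv_cancel (T.s_incl_rng u σ)
  have h1 : T.incl (z, rng (T.proj σ)) = T.incl (w, rng (T.proj σ)) := by
    rw [← hz, ← hz]
    exact congrArg (fun a => mul a (inv σ)) h
  exact congrArg Prod.fst (T.isEmbedding_incl.injective h1)

/-! ### The total space of a twist is locally compact and Hausdorff -/

theorem continuous_proj : Continuous T.proj := T.isOpenQuotientMap_proj.continuous

theorem isOpenMap_proj : IsOpenMap T.proj := T.isOpenQuotientMap_proj.isOpenMap

theorem continuous_act : Continuous fun p : Circle × E => T.act p.1 p.2 := by
  have h : Continuous fun p : Circle × E => (T.incl (p.1, rng (T.proj p.2)), p.2) :=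
    (T.isEmbedding_incl.continuous.comp (continuous_fst.prodMk
      (continuous_rng.comp (T.continuous_proj.comp continuous_snd)))).prodMk continuous_snd
  exact TopologicalGroupoid.continuousOn_mul.comp_continuous h fun p => T.s_incl_rng p.1 p.2

open Filter Topology in
/-- Distinct points of one fibre of `E → G` are separated by the continuous division map of that
fibre, whose values lie in the embedded copy of `𝕋 × G⁽⁰⁾`. -/
theorem t2Space (T : Twist G E) [T2Space G] : T2Space E := by
  rw [t2_iff_ultrafilter]
  intro σ τ F hσ hτ
  have hp : T.proj σ = T.proj τ := tendsto_nhds_unique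
    ((T.continuous_proj.tendsto σ).mono_left hσ) ((T.continuous_proj.tendsto τ).mono_left hτ)
  have hs : s σ = s τ := s_eq_of_src T (by rw [hp])
  have hc : s σ = r (inv τ) := hs.trans (ArrowGroupoid.r_inv τ).symm
  obtain ⟨z, x, hzx⟩ := T.exact (mul σ (inv τ)) (by
    rw [T.proj_mul_inv hs, hp, ArrowGroupoid.mul_inv_self]; exact ArrowGroupoid.r_r _)
  -- along `F`, the units `ρ ρ⁻¹` converge to `σ τ⁻¹`, so the circle coordinate of the latter is `1`
  have h1 : Tendsto (fun ρ : E => (ρ, inv ρ)) F (𝓝[{p : E × E | s p.1 = r p.2}] (σ, inv τ)) := by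
    refine tendsto_nhdsWithin_iff.2 ⟨?_, Eventually.of_forall fun ρ => ?_⟩
    · exact Tendsto.prodMk_nhds hσ
        ((TopologicalGroupoid.continuous_inv.tendsto τ).mono_left hτ)
    · exact (ArrowGroupoid.r_inv ρ).symm
  have h2 := Tendsto.comp (TopologicalGroupoid.continuousOn_mul (σ, inv τ) hc) h1
  have h3 : Tendsto (T.incl ∘ fun ρ : E => ((1 : Circle), rng (T.proj ρ))) F
      (𝓝 (T.incl (z, x))) := by
    rw [← hzx]
    refine h2.congr fun ρ => ?_
    simp only [Function.comp, T.incl_one_rng, ArrowGroupoid.mul_inv_self]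
  have h4 := (continuous_fst.tendsto _).comp (T.isEmbedding_incl.tendsto_nhds_iff.2 h3)
  have h5 : z = 1 := tendsto_nhds_unique h4 tendsto_const_nhds
  have h6 : s (inv σ) = r τ := by
    rw [ArrowGroupoid.s_inv]; exact T.r_eq_of_rng (by rw [hp])
  have h7 : x = rng (T.proj τ) := by
    have := congrArg (fun a => rng (T.proj a)) hzx
    simp only [T.rng_proj_incl] at this
    rw [← this, ← hp]
    exact T.rng_proj_eq (ArrowGroupoid.r_mul _ _ hc)
  rw [← mul_inv_mul_cancel hs, hzx, h5, h7, T.incl_one_rng, ArrowGroupoid.r_mul_self]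

open Filter Topology in
/-- `E → G` is proper, being the quotient map for an action of the compact group `𝕋`. -/
theorem isCompact_preimage_proj {K : Set G} (hK : IsCompact K) : IsCompact (T.proj ⁻¹' K) := by
  rw [isCompact_iff_ultrafilter_le_nhds]
  intro F hF
  obtain ⟨γ, hγK, hγ⟩ := isCompact_iff_ultrafilter_le_nhds.1 hK (F.map T.proj) (by
    rw [le_principal_iff] at hF ⊢; exact hF)
  obtain ⟨σ, rfl⟩ := T.isOpenQuotientMap_proj.surjective γ
  -- every neighbourhood of the `𝕋`-orbit of `σ` belongs to `F`
  have h1 : (F : Filter E) ≤ map (fun p : Circle × E => T.act p.1 p.2) (⊤ ×ˢ 𝓝 σ) := by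
    intro U hU
    obtain ⟨A, hA, O, hO, hAO⟩ := mem_prod_iff.1 (mem_map.1 hU)
    rw [mem_top] at hA
    have h2 : T.proj ⁻¹' (T.proj '' O) ∈ F := hγ (T.isOpenMap_proj.image_mem_nhds hO)
    filter_upwards [h2] with ρ hρ
    obtain ⟨τ, hτ, hτρ⟩ := hρ
    obtain ⟨z, rfl⟩ := T.exists_act_eq hτρ.symm
    exact hAO (Set.mk_mem_prod (hA ▸ Set.mem_univ z) hτ)
  have h2 : NeBot (comap (fun p : Circle × E => T.act p.1 p.2) F ⊓ (⊤ ×ˢ 𝓝 σ)) := by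
    rw [← map_neBot_iff (fun p : Circle × E => T.act p.1 p.2), inf_comm, Filter.push_pull,
      inf_eq_right.2 h1]
    infer_instance
  obtain ⟨V, hV⟩ := Ultrafilter.exists_le (comap (fun p : Circle × E => T.act p.1 p.2) F ⊓
    (⊤ ×ˢ 𝓝 σ))
  have hVF : V.map (fun p : Circle × E => T.act p.1 p.2) = F :=
    Ultrafilter.coe_le_coe.1 (map_le_iff_le_comap.2 (hV.trans inf_le_left))
  obtain ⟨z, -, hz⟩ := isCompact_iff_ultrafilter_le_nhds.1 (isCompact_univ (X := Circle))
    (V.map Prod.fst) (by simp)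
  have h3 : Tendsto (fun p : Circle × E => (p.1, p.2)) V (𝓝 (z, σ)) :=
    Tendsto.prodMk_nhds hz (tendsto_snd.mono_left (hV.trans inf_le_right))
  refine ⟨T.act z σ, ?_, ?_⟩
  · rw [Set.mem_preimage, T.proj_act]; exact hγK
  · rw [← hVF]
    exact (T.continuous_act.tendsto (z, σ)).comp h3

theorem weaklyLocallyCompactSpace (T : Twist G E) [LocallyCompactSpace G] : WeaklyLocallyCompactSpace E := by
  refine ⟨fun σ => ?_⟩
  obtain ⟨K, hK, hKn⟩ := exists_compact_mem_nhds (T.proj σ)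
  exact ⟨_, T.isCompact_preimage_proj hK, T.continuous_proj.continuousAt.preimage_mem_nhds hKn⟩

end Twist

theorem continuous_circle_coe : Continuous fun z : Circle => (z : ℂ) := continuous_induced_dom

namespace Twist

variable {G E : Type*} [TopologicalSpace G] [TopologicalGroupoid G]
  [TopologicalSpace E] [TopologicalGroupoid E] (T : Twist G E)

/-! ### Existence of compactly supported sections -/

open MeasureTheory in
/-- Averaging a function on `E` against the character `z ↦ z` of the compact group `𝕋` makes it a
section of the line bundle. -/
theorem exists_equivariant_average (g : C(E, ℝ)) :
    ∃ f : E → ℂ, Continuous f ∧ (∀ z σ, f (T.act z σ) = f σ * conj (z : ℂ)) ∧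
      (∀ σ, (∀ z, g (T.act z σ) = 0) → f σ = 0) ∧
      ∀ σ, 0 < g σ → (∀ z, 0 ≤ g (T.act z σ)) →
        (∀ z : Circle, (z : ℂ).re ≤ 0 → g (T.act z σ) = 0) → f σ ≠ 0 := by
  let _ : MeasurableSpace Circle := borel Circle
  have _ : BorelSpace Circle := ⟨rfl⟩
  let μ : Measure Circle := Measure.haar
  have hcont : Continuous (Function.uncurry fun (σ : E) (z : Circle) =>
      (g (T.act z σ) : ℂ) * (z : ℂ)) := by
    have h1 : Continuous fun p : E × Circle => g (T.act p.2 p.1) :=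
      g.continuous.comp (T.continuous_act.comp continuous_swap)
    exact (Complex.continuous_ofReal.comp h1).mul
      (continuous_circle_coe.comp continuous_snd)
  refine ⟨fun σ => ∫ z, (g (T.act z σ) : ℂ) * (z : ℂ) ∂μ, ?_, fun w σ => ?_, fun σ h => ?_,
    fun σ h0 hnn hre => ?_⟩
  · rw [← continuousOn_univ]
    exact continuousOn_integral_of_compact_support isCompact_univ hcont.continuousOn
      fun _ z _ hz => absurd (Set.mem_univ z) hz
  · have h := integral_mul_left_eq_self (μ := μ)
      (fun z : Circle => (g (T.act z σ) : ℂ) * ((z : ℂ) * conj (w : ℂ))) w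
    have h1 : ∀ z : Circle, ((w * z : Circle) : ℂ) * conj (w : ℂ) = z := by
      intro z
      rw [Circle.coe_mul, mul_right_comm, Complex.mul_conj, Circle.normSq_coe]
      simp
    simp only [h1] at h
    have h2 : ∀ z : Circle, T.act z (T.act w σ) = T.act (w * z) σ := fun z => by
      rw [T.act_act, mul_comm]
    simp only [h2]
    rw [h, ← integral_mul_const]
    simp only [mul_assoc]
  · simp [h]
  · have hc : Continuous fun z : Circle => (g (T.act z σ) : ℂ) * (z : ℂ) :=
      hcont.comp (Continuous.prodMk continuous_const continuous_id)
    have hint : Integrable (fun z : Circle => (g (T.act z σ) : ℂ) * (z : ℂ)) μ :=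
      hc.integrable_of_hasCompactSupport (HasCompactSupport.of_compactSpace _)
    have h1 : 0 < ∫ z, ((g (T.act z σ) : ℂ) * (z : ℂ)).re ∂μ := by
      apply Continuous.integral_pos_of_hasCompactSupport_nonneg_nonzero (x := 1)
        (Complex.continuous_re.comp hc) (HasCompactSupport.of_compactSpace _)
      · intro z
        change 0 ≤ ((g (T.act z σ) : ℂ) * (z : ℂ)).re
        rw [Complex.re_ofReal_mul]
        by_cases hz : (z : ℂ).re ≤ 0
        · rw [hre z hz, zero_mul]
        · exact mul_nonneg (hnn z) (le_of_not_ge hz)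
      · change ((g (T.act 1 σ) : ℂ) * ((1 : Circle) : ℂ)).re ≠ 0
        rw [T.act_one, Complex.re_ofReal_mul, Circle.coe_one, Complex.one_re, mul_one]
        exact h0.ne'
    intro h2
    have h3 := Complex.reCLM.integral_comp_comm hint
    change ∫ z, ((g (T.act z σ) : ℂ) * (z : ℂ)).re ∂μ = (∫ z, (g (T.act z σ) : ℂ) * (z : ℂ) ∂μ).re
      at h3
    change ∫ z, (g (T.act z σ) : ℂ) * (z : ℂ) ∂μ = 0 at h2
    rw [h3, h2] at h1
    exact h1.ne rfl

/-- There are enough continuous compactly supported sections. -/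
theorem exists_ccSection [T2Space G] [LocallyCompactSpace G] {W : Set G} (hW : IsOpen W) {σ : E}
    (hσ : T.proj σ ∈ W) : ∃ f : T.CcSection, f.toFun σ ≠ 0 ∧ T.openSupport f.toFun ⊆ W := by
  have := T.t2Space
  have := T.weaklyLocallyCompactSpace
  obtain ⟨K, hK, hKσ, hKW⟩ := exists_compact_subset hW hσ
  -- the part of the orbit of `σ` on which the character has nonpositive real part
  let A : Set E := (fun z : Circle => T.act z σ) '' {z | (z : ℂ).re ≤ 0}
  have hA : IsClosed A := by
    have h1 : IsClosed {z : Circle | (z : ℂ).re ≤ 0} :=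
      isClosed_le (Complex.continuous_re.comp continuous_circle_coe) continuous_const
    exact (h1.isCompact.image
      (T.continuous_act.comp (Continuous.prodMk continuous_id continuous_const))).isClosed
  have hσA : σ ∉ A := by
    rintro ⟨z, hz, h⟩
    have h1 : z = 1 := T.act_injective σ (h.trans (T.act_one σ).symm)
    rw [h1] at hz
    norm_num at hz
  obtain ⟨g, hg1, hg0, -, hg⟩ := exists_continuous_one_zero_of_isCompact (isCompact_singleton (x := σ))
    (hA.union ((isOpen_interior (s := K)).preimage T.continuous_proj).isClosed_compl) (by
      rw [Set.disjoint_singleton_left]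
      rintro (h | h)
      · exact hσA h
      · exact h hKσ)
  obtain ⟨f, hfc, hfe, hf0, hf1⟩ := T.exists_equivariant_average g
  have hsupp : T.openSupport f ⊆ K := by
    rintro _ ⟨τ, hτ, rfl⟩
    by_contra h
    refine hτ (hf0 τ fun z => hg0 (Or.inr fun h1 => h ?_))
    rw [Set.mem_preimage, T.proj_act] at h1
    exact interior_subset h1
  refine ⟨⟨f, hfe, hfc, ?_⟩, ?_, hsupp.trans hKW⟩
  · exact hK.of_isClosed_subset isClosed_closure (closure_minimal hsupp hK.isClosed)
  · refine hf1 σ ?_ (fun z => (hg _).1) fun z hz => hg0 (Or.inl ⟨z, hz, rfl⟩)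
    rw [hg1 rfl]
    exact one_pos

end Twist

namespace Twist

variable {G E : Type*} [TopologicalSpace G] [TopologicalGroupoid G]
  [TopologicalSpace E] [TopologicalGroupoid E] (T : Twist G E)

/-! ### Point values and basis vectors of the Hilbert spaces `H_x` -/

section Value

variable {x : unitSpace G}

theorem value_congr (ξ : T.H x) {σ τ : E} (h : σ = τ) (hσ : src (T.proj σ) = x) :
    T.value ξ σ hσ = T.value ξ τ (h ▸ hσ) := by
  subst h; rfl

theorem evalAt_eq_value (ξ : T.H x) (γ : {γ : G // src γ = x}) (σ : T.Above γ.1) :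
    T.evalAt σ (ξ γ) = T.value ξ σ.1 (σ.2.symm ▸ γ.2) := by
  obtain ⟨γ, hγ⟩ := γ
  obtain ⟨σ, hσ⟩ := σ
  change T.proj σ = γ at hσ
  subst hσ
  rfl

theorem value_act (ξ : T.H x) (z : Circle) (σ : E) (hσ : src (T.proj σ) = x)
    (h : src (T.proj (T.act z σ)) = x) :
    T.value ξ (T.act z σ) h = T.value ξ σ hσ * conj (z : ℂ) := by
  rw [← T.evalAt_eq_value ξ ⟨T.proj σ, hσ⟩ ⟨T.act z σ, T.proj_act z σ⟩]
  exact T.evalAt_act z ⟨σ, rfl⟩ _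

theorem value_ext {ξ η : T.H x} (h : ∀ σ hσ, T.value ξ σ hσ = T.value η σ hσ) : ξ = η := by
  ext γ
  apply T.lineFiber_ext
  intro σ
  rw [evalAt_eq_value, evalAt_eq_value, h]

theorem value_add (ξ η : T.H x) (σ : E) (hσ : src (T.proj σ) = x) :
    T.value (ξ + η) σ hσ = T.value ξ σ hσ + T.value η σ hσ := by
  rw [value, lp.coeFn_add, Pi.add_apply, map_add]; rfl

theorem value_smul (c : ℂ) (ξ : T.H x) (σ : E) (hσ : src (T.proj σ) = x) :
    T.value (c • ξ) σ hσ = c * T.value ξ σ hσ := by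
  rw [value, lp.coeFn_smul, Pi.smul_apply, map_smul]; rfl

theorem value_zero (σ : E) (hσ : src (T.proj σ) = x) : T.value (0 : T.H x) σ hσ = 0 := by
  rw [value, lp.coeFn_zero, Pi.zero_apply, map_zero]

theorem value_sub (ξ η : T.H x) (σ : E) (hσ : src (T.proj σ) = x) :
    T.value (ξ - η) σ hσ = T.value ξ σ hσ - T.value η σ hσ := by
  rw [value, lp.coeFn_sub, Pi.sub_apply, map_sub]; rfl

theorem norm_value_le (ξ : T.H x) (σ : E) (hσ : src (T.proj σ) = x) :
    ‖T.value ξ σ hσ‖ ≤ ‖ξ‖ := by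
  rw [value, ← T.norm_eq_evalAt]
  exact lp.norm_apply_le_norm (by norm_num) ξ _

theorem value_mulOp (h : ZeroAtInftyContinuousMap (unitSpace G) ℂ) (ξ : T.H x) (σ : E)
    (hσ : src (T.proj σ) = x) :
    T.value (T.mulOp h x ξ) σ hσ = h (rng (T.proj σ)) * T.value ξ σ hσ := by
  rw [value, mulOp_apply, map_smul]; rfl

/-- The element of the line `L_{ρ̇}` taking the value `1` at `ρ`. -/
noncomputable def fiberOne (ρ : E) : T.LineFiber (T.proj ρ) :=
  T.mkFiber (fun σ => conj ((Classical.choose (T.exists_act_eq σ.2) : Circle) : ℂ)) fun z σ => by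
    rw [← map_mul, ← Circle.coe_mul]
    congr 2
    have h1 := Classical.choose_spec (T.exists_act_eq σ.2)
    have h2 := Classical.choose_spec (T.exists_act_eq ((T.proj_act z σ.1).trans σ.2))
    apply T.act_injective ρ
    change T.act _ ρ = T.act _ ρ
    rw [← h2, mul_comm, ← T.act_act, ← h1]

theorem evalAt_fiberOne (ρ : E) : T.evalAt ⟨ρ, rfl⟩ (T.fiberOne ρ) = 1 := by
  have h := Classical.choose_spec (T.exists_act_eq (rfl : T.proj ρ = T.proj ρ))
  have h1 : Classical.choose (T.exists_act_eq (rfl : T.proj ρ = T.proj ρ)) = 1 :=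
    T.act_injective ρ (h.symm.trans (T.act_one ρ).symm)
  change conj ((Classical.choose (T.exists_act_eq (rfl : T.proj ρ = T.proj ρ)) : Circle) : ℂ) = 1
  rw [h1, Circle.coe_one, map_one]

open Classical in
/-- The unit vector `e_ρ` of `H_x` equal to `1` at `ρ` and supported on the orbit `𝕋ρ`. -/
noncomputable def basisVec (ρ : E) (x : unitSpace G) (h : src (T.proj ρ) = x) : T.H x :=
  lp.single 2 ⟨T.proj ρ, h⟩ (T.fiberOne ρ)

theorem value_basisVec_self (ρ : E) (h : src (T.proj ρ) = x) :
    T.value (T.basisVec ρ x h) ρ h = 1 := by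
  classical
  rw [value, basisVec, lp.single_apply_self, evalAt_fiberOne]

theorem value_basisVec_of_ne (ρ : E) (h : src (T.proj ρ) = x) {σ : E}
    (hσ : src (T.proj σ) = x) (hne : T.proj σ ≠ T.proj ρ) :
    T.value (T.basisVec ρ x h) σ hσ = 0 := by
  classical
  rw [value, basisVec, lp.single_apply_ne, map_zero]
  exact fun h1 => hne (congrArg Subtype.val h1)

theorem norm_basisVec (ρ : E) (h : src (T.proj ρ) = x) : ‖T.basisVec ρ x h‖ = 1 := by
  classical
  rw [basisVec, lp.norm_single (by norm_num), T.norm_eq_evalAt ⟨ρ, rfl⟩, evalAt_fiberOne, norm_one]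

theorem eq_basisVec {ξ : T.H x} (ρ : E) (h : src (T.proj ρ) = x) (h1 : T.value ξ ρ h = 1)
    (h0 : ∀ σ hσ, T.proj σ ≠ T.proj ρ → T.value ξ σ hσ = 0) : ξ = T.basisVec ρ x h := by
  apply T.value_ext
  intro σ hσ
  by_cases hne : T.proj σ = T.proj ρ
  · obtain ⟨z, rfl⟩ := T.exists_act_eq hne
    rw [T.value_act ξ z ρ h, T.value_act _ z ρ h, h1, value_basisVec_self]
  · rw [h0 σ hσ hne, value_basisVec_of_ne _ _ _ _ hne]

theorem inner_basisVec (ρ : E) (h : src (T.proj ρ) = x) (ξ : T.H x) :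
    inner ℂ (T.basisVec ρ x h) ξ = T.value ξ ρ h := by
  classical
  have h1 : ∀ {γ : G} (σ : T.Above γ) (φ ψ : T.LineFiber γ),
      inner ℂ φ ψ = conj (T.evalAt σ φ) * T.evalAt σ ψ := by
    intro γ σ φ ψ
    obtain ⟨z, hz⟩ := T.exists_act_eq (σ.2.trans (T.base γ).2.symm)
    have h : σ = ⟨T.act z (T.base γ), (T.proj_act z (T.base γ).1).trans (T.base γ).2⟩ :=
      Subtype.ext hz
    change conj (T.evalAt (T.base γ) φ) * T.evalAt (T.base γ) ψ = _
    rw [h, T.evalAt_act, T.evalAt_act, map_mul, Complex.conj_conj, mul_mul_mul_comm,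
      Complex.mul_conj, Circle.normSq_coe, Complex.ofReal_one, mul_one]
  rw [basisVec, lp.inner_single_left, h1 ⟨ρ, rfl⟩, evalAt_fiberOne, map_one, one_mul]
  rfl

theorem clm_ext {a b : T.H x →L[ℂ] T.H x}
    (h : ∀ ρ hρ, a (T.basisVec ρ x hρ) = b (T.basisVec ρ x hρ)) : a = b := by
  classical
  ext1 ξ
  have hs := lp.hasSum_single (p := 2) (by norm_num) ξ
  refine (hs.mapL a).unique ?_
  convert hs.mapL b using 2 with γ
  -- each fibre is a line, so `single γ (ξ γ)` is a multiple of a basis vector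
  have h1 : src (T.proj (T.lift γ.1)) = x := by rw [T.proj_lift, γ.2]
  have h2 : lp.single 2 γ (ξ γ) = T.value ξ (T.lift γ.1) h1 • T.basisVec (T.lift γ.1) x h1 := by
    have h3 : T.value (lp.single 2 γ (ξ γ)) (T.lift γ.1) h1 = T.value ξ (T.lift γ.1) h1 := by
      have h4 := T.evalAt_eq_value (lp.single 2 γ (ξ γ)) γ (T.base γ.1)
      rw [lp.single_apply_self, T.evalAt_eq_value ξ γ (T.base γ.1)] at h4
      exact h4.symm
    apply T.value_ext
    intro σ hσ
    rw [value_smul]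
    by_cases hne : T.proj σ = T.proj (T.lift γ.1)
    · obtain ⟨z, rfl⟩ := T.exists_act_eq hne
      rw [T.value_act _ z _ h1, T.value_act _ z _ h1, h3, value_basisVec_self, one_mul]
    · rw [value_basisVec_of_ne _ _ _ _ hne, mul_zero, value, lp.single_apply_ne, map_zero]
      intro h4
      rw [T.proj_lift] at hne
      exact hne (congrArg Subtype.val h4)
  rw [h2, map_smul, map_smul, h]

variable (x) in
theorem unitVector_eq_basisVec :
    T.unitVector x = T.basisVec (T.incl (1, x)) x (T.src_proj_incl 1 x) := by
  classical
  have hx : src (x : G) = x := src_coe x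
  apply T.eq_basisVec
  · rw [← T.evalAt_eq_value _ ⟨(x : G), hx⟩ ⟨T.incl (1, x), T.proj_incl 1 x⟩, unitVector,
      lp.single_apply_self, evalAt_unitFiber, Circle.coe_one, map_one]
  · intro σ hσ hne
    rw [value, unitVector, lp.single_apply_ne, map_zero]
    intro h1
    rw [T.proj_incl] at hne
    exact hne (congrArg Subtype.val h1)

theorem value_unitVector (z : Circle) :
    T.value (T.unitVector x) (T.incl (z, x)) (T.src_proj_incl z x) = conj (z : ℂ) := by
  have h1 : T.incl (z, x) = T.act z (T.incl (1, x)) := by rw [T.act_incl, mul_one]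
  rw [T.value_congr _ h1, T.value_act _ z _ (T.src_proj_incl 1 x), unitVector_eq_basisVec,
    value_basisVec_self, one_mul]

theorem value_unitVector_of_ne {σ : E} (hσ : src (T.proj σ) = x) (hne : T.proj σ ≠ x) :
    T.value (T.unitVector x) σ hσ = 0 := by
  rw [unitVector_eq_basisVec]
  apply T.value_basisVec_of_ne
  rwa [T.proj_incl]

variable (x) in
theorem norm_unitVector : ‖T.unitVector x‖ = 1 := by
  rw [unitVector_eq_basisVec, norm_basisVec]

end Value

/-! ### Sections given by families of operators -/

variable {T}

theorem value_component_unitVector (a : T.BoundedFamilies) {x : unitSpace G} (σ : E)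
    (h : src (T.proj σ) = x) : T.value (a.component x (T.unitVector x)) σ h = toSection a σ := by
  subst h; rfl

theorem toSection_add (a b : T.BoundedFamilies) (σ : E) :
    toSection (a + b) σ = toSection a σ + toSection b σ := by
  rw [toSection, BoundedFamilies.component_add, add_apply, value_add]; rfl

theorem toSection_smul (c : ℂ) (a : T.BoundedFamilies) (σ : E) :
    toSection (c • a) σ = c * toSection a σ := by
  rw [toSection, BoundedFamilies.component_smul, smul_apply, value_smul]; rfl

theorem toSection_zero (σ : E) : toSection (0 : T.BoundedFamilies) σ = 0 := by
  rw [toSection, BoundedFamilies.component_zero, zero_apply, value_zero]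

theorem toSection_sub (a b : T.BoundedFamilies) (σ : E) :
    toSection (a - b) σ = toSection a σ - toSection b σ := by
  have h : a - b = a + (-1 : ℂ) • b := by rw [neg_one_smul, sub_eq_add_neg]
  rw [h, toSection_add, toSection_smul]; ring

theorem norm_toSection_le (a : T.BoundedFamilies) (σ : E) : ‖toSection a σ‖ ≤ ‖a‖ := by
  refine (T.norm_value_le _ _ _).trans (((a.component _).le_opNorm _).trans ?_)
  rw [norm_unitVector, mul_one]
  exact a.norm_component_le _

theorem toSection_act (a : T.BoundedFamilies) (z : Circle) (σ : E) :
    toSection a (T.act z σ) = toSection a σ * conj (z : ℂ) := by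
  have h : src (T.proj (T.act z σ)) = src (T.proj σ) := by rw [T.proj_act]
  rw [← value_component_unitVector a _ h, T.value_act _ z σ rfl]; rfl

theorem mem_supp' {a : T.BoundedFamilies} {σ : E} : T.proj σ ∈ supp' a ↔ toSection a σ ≠ 0 := by
  refine ⟨?_, fun h => ⟨σ, h, rfl⟩⟩
  rintro ⟨τ, hτ, h⟩
  obtain ⟨z, rfl⟩ := T.exists_act_eq h.symm
  rw [toSection_act]
  exact mul_ne_zero hτ ((map_ne_zero _).2 (Circle.coe_ne_zero z))

/-! ### Right-invariant families -/

theorem src_proj_mul_inv (T : Twist G E) {σ τ : E} (h : src (T.proj σ) = src (T.proj τ)) :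
    src (T.proj (mul σ (inv τ))) = rng (T.proj τ) := by
  rw [T.proj_mul_inv (s_eq_of_src T h), src_mul (by rw [rng_inv, h]), src_inv]

theorem rng_proj_mul_inv (T : Twist G E) {σ τ : E} (h : src (T.proj σ) = src (T.proj τ)) :
    rng (T.proj (mul σ (inv τ))) = rng (T.proj σ) := by
  rw [T.proj_mul_inv (s_eq_of_src T h), rng_mul (by rw [rng_inv, h])]

/-- `η` is the right translate of `ξ` by `τ`: `η(σ) = ξ(σ τ⁻¹)`. -/
def IsTranslate (τ : E) (η : T.H (src (T.proj τ))) (ξ : T.H (rng (T.proj τ))) : Prop :=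
  ∀ (σ : E) (hσ : src (T.proj σ) = src (T.proj τ)),
    T.value η σ hσ = T.value ξ (mul σ (inv τ)) (T.src_proj_mul_inv hσ)

/-- A family of operators `a_x` commuting with the right translations `H_{r(τ)} → H_{s(τ)}`. -/
def IsInvariant (a : T.BoundedFamilies) : Prop :=
  ∀ (τ : E) (η : T.H (src (T.proj τ))) (ξ : T.H (rng (T.proj τ))), IsTranslate τ η ξ →
    IsTranslate τ (a.component _ η) (a.component _ ξ)

theorem isTranslate_basisVec (ρ : E) :
    IsTranslate ρ (T.basisVec ρ _ rfl) (T.unitVector (rng (T.proj ρ))) := by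
  intro σ hσ
  by_cases h : T.proj σ = T.proj ρ
  · obtain ⟨z, rfl⟩ := T.exists_act_eq h
    have h1 : mul (T.act z ρ) (inv ρ) = T.incl (z, rng (T.proj ρ)) :=
      mul_mul_inv_cancel (T.s_incl_rng z ρ)
    rw [T.value_act _ z ρ rfl, value_basisVec_self, T.value_congr _ h1, value_unitVector, one_mul]
  · rw [value_basisVec_of_ne _ _ _ _ h, value_unitVector_of_ne]
    intro h1
    apply h
    rw [← mul_inv_mul_cancel (congrArg Subtype.val hσ), ← T.proj_mul_inv (s_eq_of_src T hσ), h1]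
    exact ArrowGroupoid.r_mul_self _

namespace IsInvariant

variable {a b : T.BoundedFamilies}

/-- The matrix coefficients of an invariant family are the values of its section. -/
theorem value_basisVec (ha : IsInvariant a) {x : unitSpace G} {ρ σ : E} (hρ : src (T.proj ρ) = x)
    (hσ : src (T.proj σ) = x) :
    T.value (a.component x (T.basisVec ρ x hρ)) σ hσ = toSection a (mul σ (inv ρ)) := by
  subst hρ
  rw [ha ρ _ _ (isTranslate_basisVec ρ) σ hσ, value_component_unitVector]

theorem ext (ha : IsInvariant a) (hb : IsInvariant b) (h : toSection a = toSection b) : a = b := by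
  apply BoundedFamilies.ext
  intro x
  apply T.clm_ext
  intro ρ hρ
  apply T.value_ext
  intro σ hσ
  rw [ha.value_basisVec, hb.value_basisVec, h]

theorem add (ha : IsInvariant a) (hb : IsInvariant b) : IsInvariant (a + b) := by
  intro τ η ξ h σ hσ
  rw [BoundedFamilies.component_add, BoundedFamilies.component_add, add_apply,
    add_apply, value_add, value_add, ha τ η ξ h, hb τ η ξ h]

theorem smul (c : ℂ) (ha : IsInvariant a) : IsInvariant (c • a) := by
  intro τ η ξ h σ hσ
  rw [BoundedFamilies.component_smul, BoundedFamilies.component_smul,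
    smul_apply, smul_apply, value_smul, value_smul,
    ha τ η ξ h]

theorem zero : IsInvariant (0 : T.BoundedFamilies) := by
  intro τ η ξ _ σ hσ
  rw [BoundedFamilies.component_zero, BoundedFamilies.component_zero,
    zero_apply, zero_apply, value_zero, value_zero]

theorem mul (ha : IsInvariant a) (hb : IsInvariant b) : IsInvariant (a * b) := by
  intro τ η ξ h
  rw [BoundedFamilies.component_mul, BoundedFamilies.component_mul]
  exact ha τ _ _ (hb τ η ξ h)

theorem of_mem_closure {S : Set T.BoundedFamilies} (hS : ∀ b ∈ S, IsInvariant b)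
    (ha : a ∈ closure S) : IsInvariant a := by
  intro τ η ξ h σ hσ
  have hlim : ∀ {x : unitSpace G} (ζ : T.H x) (ρ : E) (hρ : src (T.proj ρ) = x),
      Continuous fun b : T.BoundedFamilies => T.value (b.component x ζ) ρ hρ := by
    intro x ζ ρ hρ
    refine (LipschitzWith.of_dist_le_mul (K := ‖ζ‖₊) fun b c => ?_).continuous
    rw [dist_eq_norm, dist_eq_norm, ← T.value_sub, ← sub_apply, mul_comm]
    refine (T.norm_value_le _ _ _).trans (((b.component x - c.component x).le_opNorm ζ).trans ?_)
    exact mul_le_mul_of_nonneg_right ((b - c).norm_component_le x) (norm_nonneg _)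
  exact closure_minimal (fun b hb => hS b hb τ η ξ h σ hσ)
    (isClosed_eq (hlim η σ hσ) (hlim ξ _ (T.src_proj_mul_inv hσ))) ha

theorem unitHom (h : ZeroAtInftyContinuousMap (unitSpace G) ℂ) : IsInvariant (T.unitHom h) := by
  intro τ η ξ hηξ σ hσ
  change T.value (T.mulOp h _ η) σ hσ = T.value (T.mulOp h _ ξ) _ _
  rw [value_mulOp, value_mulOp, hηξ σ hσ, T.rng_proj_mul_inv hσ]

end IsInvariant

end Twist

namespace Twist

variable {G E : Type*} [TopologicalSpace G] [TopologicalGroupoid G]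
  [TopologicalSpace E] [TopologicalGroupoid E] {T : Twist G E}

/-! ### The operators `π_x(f)` -/

namespace CcSection

theorem src_proj_lift {x : unitSpace G} (γ : {γ : G // src γ = x}) :
    src (T.proj (T.lift γ.1)) = x := by rw [T.proj_lift, γ.2]

/-- The summand of the convolution depends only on the image of `τ` in `G`. -/
theorem coeff_mul_value_congr (f : T.CcSection) {x : unitSpace G} (ξ : T.H x) {σ τ ρ : E}
    (hσ : src (T.proj σ) = x) (hτ : src (T.proj τ) = x) (hρ : src (T.proj ρ) = x)
    (h : T.proj τ = T.proj ρ) :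
    f.coeff σ τ * T.value ξ τ hτ = f.coeff σ ρ * T.value ξ ρ hρ := by
  obtain ⟨z, rfl⟩ := T.exists_act_eq h
  have hs : s σ = s ρ := s_eq_of_src T (hσ.trans hρ.symm)
  have h1 : f.coeff σ (T.act z ρ) = f.coeff σ ρ * z := by
    rw [coeff, T.inv_act, T.mul_act _ (hs.trans (ArrowGroupoid.r_inv ρ).symm), f.equivariant,
      coeff, ← Circle.coe_inv_eq_conj, inv_inv]
  rw [h1, T.value_act _ z ρ hρ, mul_mul_mul_comm, Complex.mul_conj, Circle.normSq_coe,
    Complex.ofReal_one, mul_one]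

theorem convSum_eq_tsum_value (f : T.CcSection) {x : unitSpace G} (ξ : T.H x) (σ : E) :
    f.convSum ξ σ = ∑' γ : {γ : G // src γ = x},
      f.coeff σ (T.lift γ.1) * T.value ξ (T.lift γ.1) (src_proj_lift γ) := by
  refine tsum_congr fun γ => ?_
  rw [T.evalAt_eq_value ξ γ (T.base γ.1)]
  rfl

variable [IsEtale G]

theorem value_regRep (f : T.CcSection) {x : unitSpace G} (ξ : T.H x) (σ : E)
    (hσ : src (T.proj σ) = x) : T.value (f.regRep x ξ) σ hσ = f.convSum ξ σ := rfl

theorem value_regRep_basisVec (f : T.CcSection) {x : unitSpace G} {ρ σ : E}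
    (hρ : src (T.proj ρ) = x) (hσ : src (T.proj σ) = x) :
    T.value (f.regRep x (T.basisVec ρ x hρ)) σ hσ = f.coeff σ ρ := by
  rw [value_regRep, convSum_eq_tsum_value, tsum_eq_single ⟨T.proj ρ, hρ⟩]
  · rw [f.coeff_mul_value_congr _ hσ _ hρ (T.proj_lift _), value_basisVec_self, mul_one]
  · intro γ hγ
    rw [value_basisVec_of_ne, mul_zero]
    rw [T.proj_lift]
    exact fun h => hγ (Subtype.ext h)

theorem toSection_reg (f : T.CcSection) : toSection f.reg = f.toFun := by
  funext σ
  have h : T.toSection f.reg σ = T.value (f.regRep _ (T.unitVector (src (T.proj σ)))) σ rfl := rfl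
  rw [h, unitVector_eq_basisVec, value_regRep_basisVec, coeff, T.incl_one_src,
    inv_of_mem_unitSpace (ArrowGroupoid.r_s σ), ArrowGroupoid.mul_s_self]

/-- The kernel `f(σ τ⁻¹)` of `π_x(f)` does not change under simultaneous right translation. -/
theorem isInvariant_reg (f : T.CcSection) : IsInvariant f.reg := by
  intro τ η ξ h σ hσ
  change f.convSum η σ = f.convSum ξ (mul σ (inv τ))
  have hs : s σ = s τ := s_eq_of_src T hσ
  -- right translation by `τ` identifies the fibres over which the two sums are taken
  let e : {γ : G // src γ = rng (T.proj τ)} ≃ {γ : G // src γ = src (T.proj τ)} :=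
    { toFun := fun γ => ⟨mul γ.1 (T.proj τ), src_mul γ.2⟩
      invFun := fun γ => ⟨mul γ.1 (inv (T.proj τ)), by
        rw [src_mul (by rw [γ.2, rng_inv]), src_inv]⟩
      left_inv := fun γ => Subtype.ext (mul_mul_inv_cancel (congrArg Subtype.val γ.2))
      right_inv := fun γ => Subtype.ext (mul_inv_mul_cancel (congrArg Subtype.val γ.2)) }
  rw [convSum_eq_tsum_value, convSum_eq_tsum_value, ← e.tsum_eq]
  refine tsum_congr fun γ => ?_
  have hc : s (T.lift γ.1) = r τ := T.s_eq_r_of_src_eq_rng (src_proj_lift γ)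
  have hm : src (T.proj (mul (T.lift γ.1) τ)) = src (T.proj τ) := by
    rw [T.proj_mul _ _ hc, src_mul (src_proj_lift γ)]
  rw [f.coeff_mul_value_congr η hσ (src_proj_lift (e γ)) hm (by
    rw [T.proj_lift, T.proj_mul _ _ hc, T.proj_lift]; rfl), h _ hm,
    T.value_congr ξ (mul_mul_inv_cancel hc), coeff, coeff, mul_inv_mul_mul hs hc]

/-- The involution of `C_c(G, E)`: `f*(σ) = conj f(σ⁻¹)`. -/
def involution (f : T.CcSection) : T.CcSection where
  toFun σ := conj (f.toFun (inv σ))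
  equivariant z σ := by
    rw [T.inv_act, f.equivariant, map_mul, Circle.coe_inv_eq_conj, Complex.conj_conj]
  continuous := Complex.continuous_conj.comp
    (f.continuous.comp TopologicalGroupoid.continuous_inv)
  compactSupport := by
    have h : T.openSupport (fun σ => conj (f.toFun (inv σ))) =
        invHomeo G '' T.openSupport f.toFun := by
      ext γ
      constructor
      · rintro ⟨σ, hσ, rfl⟩
        refine ⟨T.proj (inv σ), ⟨inv σ, fun h => hσ (by simp [h]), rfl⟩, ?_⟩
        change inv (T.proj (inv σ)) = _
        rw [proj_inv, inv_inv']
      · rintro ⟨_, ⟨σ, hσ, rfl⟩, rfl⟩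
        refine ⟨inv σ, ?_, proj_inv T σ⟩
        change conj (f.toFun (inv (inv σ))) ≠ 0
        rw [inv_inv']
        exact (map_ne_zero _).2 hσ
    rw [h, ← Homeomorph.image_closure]
    exact f.compactSupport.image (invHomeo G).continuous

theorem star_reg (f : T.CcSection) : star f.reg = f.involution.reg := by
  apply BoundedFamilies.ext
  intro x
  apply T.clm_ext
  intro ρ hρ
  apply T.value_ext
  intro σ hσ
  change T.value (star (f.regRep x) (T.basisVec ρ x hρ)) σ hσ =
    T.value (f.involution.regRep x (T.basisVec ρ x hρ)) σ hσ
  rw [value_regRep_basisVec, ← T.inner_basisVec σ hσ, ContinuousLinearMap.star_eq_adjoint,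
    ContinuousLinearMap.adjoint_inner_right, ← inner_conj_symm, T.inner_basisVec ρ hρ,
    value_regRep_basisVec]
  change conj (f.coeff ρ σ) = conj (f.toFun (inv (mul σ (inv ρ))))
  rw [inv_mul_inv (s_eq_of_src T (hσ.trans hρ.symm)), coeff]

end CcSection

/-! ### Convolution preserves continuity and decay -/

variable (T) in
/-- A function on `E` vanishes at infinity on `G`: it is uniformly small off the preimage of a
compact subset of `G`. -/
def VanishesAtInfinity (b : E → ℂ) : Prop :=
  ∀ ε > 0, ∃ K : Set G, IsCompact K ∧ ∀ σ, T.proj σ ∉ K → ‖b σ‖ ≤ ε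

/-- If `f` is supported in a set on which the range map is injective, the convolution sum at `σ`
has a single term. -/
theorem hasSum_conv_of_injOn {f b : E → ℂ} {U : Set G} (hU : Set.InjOn rng U)
    (hf : ∀ z σ, f (T.act z σ) = f σ * conj (z : ℂ)) (hb : ∀ z σ, b (T.act z σ) = b σ * conj (z : ℂ))
    (hfU : ∀ σ, f σ ≠ 0 → T.proj σ ∈ U) {σ ρ : E} (hρ : T.proj ρ ∈ U) (hr : r ρ = r σ) :
    HasSum (fun γ : {γ : G // src γ = src (T.proj σ)} =>
      f (mul σ (inv (T.lift γ.1))) * b (T.lift γ.1)) (f ρ * b (mul (inv ρ) σ)) := by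
  have hc : s (inv ρ) = r σ := by rw [ArrowGroupoid.s_inv, hr]
  have hs : s (mul (inv ρ) σ) = s σ := ArrowGroupoid.s_mul _ _ hc
  have h1 : mul σ (inv (mul (inv ρ) σ)) = ρ := by
    rw [mul_inv_mul_mul rfl hc, inv_inv', ArrowGroupoid.mul_inv_self, ← hr,
      ArrowGroupoid.r_mul_self]
  let γ₀ : {γ : G // src γ = src (T.proj σ)} := ⟨T.proj (mul (inv ρ) σ), T.src_proj_eq hs⟩
  have h2 : f ρ * b (mul (inv ρ) σ) = f (mul σ (inv (T.lift γ₀.1))) * b (T.lift γ₀.1) := by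
    obtain ⟨z, hz⟩ := T.exists_act_eq (T.proj_lift (T.proj (mul (inv ρ) σ)))
    change _ = f (mul σ (inv (T.lift (T.proj (mul (inv ρ) σ))))) *
      b (T.lift (T.proj (mul (inv ρ) σ)))
    rw [hz, T.inv_act, T.mul_act _ (hs.symm.trans (ArrowGroupoid.r_inv _).symm), h1, hf, hb,
      mul_mul_mul_comm, Circle.coe_inv_eq_conj, Complex.conj_conj, Complex.mul_conj,
      Circle.normSq_coe, Complex.ofReal_one, mul_one]
  rw [h2]
  apply hasSum_single γ₀
  intro γ hγ
  have hsγ : s σ = s (T.lift γ.1) := s_eq_of_src T (CcSection.src_proj_lift γ).symm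
  by_contra hne
  have h3 := hU (hfU _ (left_ne_zero_of_mul hne)) hρ (by
    rw [T.rng_proj_mul_inv (CcSection.src_proj_lift γ).symm]; exact (T.rng_proj_eq hr).symm)
  apply hγ
  apply Subtype.ext
  change γ.1 = T.proj (mul (inv ρ) σ)
  have h4 : T.proj (mul (inv (mul σ (inv (T.lift γ.1)))) σ) = γ.1 := by
    have hc' : s (T.lift γ.1) = r (inv σ) := by rw [ArrowGroupoid.r_inv, hsγ]
    have h5 : mul (mul (T.lift γ.1) (inv σ)) σ = T.lift γ.1 := mul_inv_mul_cancel hsγ.symm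
    rw [inv_mul_inv hsγ, h5, T.proj_lift]
  have h6 : s (inv (mul σ (inv (T.lift γ.1)))) = r σ := by
    rw [ArrowGroupoid.s_inv, ArrowGroupoid.r_mul _ _ (hsγ.trans (ArrowGroupoid.r_inv _).symm)]
  rw [← h4, T.proj_mul _ _ h6, T.proj_mul _ _ hc, proj_inv, proj_inv, h3]

open Filter Topology in
/-- Convolution by a compactly supported section living on an open set where the range map is
injective preserves continuity and decay: its only term `f(ρ) b(ρ⁻¹ σ)` depends continuously on
`(ρ, σ)`, and the set of admissible `ρ` varies openly with `r(σ)`. -/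
theorem exists_conv_of_injOn [T2Space G] {f b : E → ℂ} {U K : Set G}
    (hUo : IsOpen U) (hU : Set.InjOn rng U) (hK : IsCompact K) (hKU : K ⊆ U)
    (hf : ∀ z σ, f (T.act z σ) = f σ * conj (z : ℂ)) (hb : ∀ z σ, b (T.act z σ) = b σ * conj (z : ℂ))
    (hfc : Continuous f) (hbc : Continuous b) (hfK : ∀ σ, f σ ≠ 0 → T.proj σ ∈ K)
    {M : ℝ} (hM : ∀ σ, ‖f σ‖ ≤ M) (hb0 : T.VanishesAtInfinity b) :
    ∃ h : E → ℂ, Continuous h ∧ T.VanishesAtInfinity h ∧ ∀ σ,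
      HasSum (fun γ : {γ : G // src γ = src (T.proj σ)} =>
        f (mul σ (inv (T.lift γ.1))) * b (T.lift γ.1)) (h σ) := by
  have hsum : ∀ σ ρ, T.proj ρ ∈ U → r ρ = r σ → HasSum
      (fun γ : {γ : G // src γ = src (T.proj σ)} =>
        f (mul σ (inv (T.lift γ.1))) * b (T.lift γ.1)) (f ρ * b (mul (inv ρ) σ)) :=
    fun σ ρ hρ hr => hasSum_conv_of_injOn hU hf hb (fun τ hτ => hKU (hfK τ hτ)) hρ hr
  have hsum0 : ∀ σ, rng (T.proj σ) ∉ rng '' K → HasSum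
      (fun γ : {γ : G // src γ = src (T.proj σ)} =>
        f (mul σ (inv (T.lift γ.1))) * b (T.lift γ.1)) 0 := by
    intro σ hσ
    convert hasSum_zero with γ
    by_contra hne
    exact hσ ⟨_, hfK _ (left_ne_zero_of_mul hne),
      T.rng_proj_mul_inv (CcSection.src_proj_lift γ).symm⟩
  have hlift : ∀ σ, ∀ γ ∈ U, rng γ = rng (T.proj σ) → ∃ ρ, T.proj ρ = γ ∧ r ρ = r σ :=
    fun σ γ _ h => ⟨T.lift γ, T.proj_lift γ, T.r_eq_of_rng (by rw [T.proj_lift, h])⟩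
  have hex : ∀ σ, ∃ c, HasSum (fun γ : {γ : G // src γ = src (T.proj σ)} =>
        f (mul σ (inv (T.lift γ.1))) * b (T.lift γ.1)) c := by
    intro σ
    by_cases hσ : rng (T.proj σ) ∈ rng '' K
    · obtain ⟨γ, hγK, hγ⟩ := hσ
      obtain ⟨ρ, rfl, hρ⟩ := hlift σ γ (hKU hγK) hγ
      exact ⟨_, hsum σ ρ (hKU hγK) hρ⟩
    · exact ⟨0, hsum0 σ hσ⟩
  choose h hh using hex
  have hval : ∀ σ ρ, T.proj ρ ∈ U → r ρ = r σ → h σ = f ρ * b (mul (inv ρ) σ) :=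
    fun σ ρ h1 h2 => (hh σ).unique (hsum σ ρ h1 h2)
  have hval0 : ∀ σ, rng (T.proj σ) ∉ rng '' K → h σ = 0 :=
    fun σ h1 => (hh σ).unique (hsum0 σ h1)
  refine ⟨h, ?_, ?_, hh⟩
  · rw [continuous_iff_continuousAt]
    intro σ
    by_cases hσ : rng (T.proj σ) ∈ rng '' K
    · obtain ⟨γ, hγK, hγ⟩ := hσ
      obtain ⟨ρ, rfl, hρ⟩ := hlift σ γ (hKU hγK) hγ
      have hF : ContinuousOn (fun p : E × E => f p.1 * b (mul (inv p.1) p.2))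
          {p | r p.1 = r p.2} := by
        refine (hfc.comp continuous_fst).continuousOn.mul (hbc.comp_continuousOn ?_)
        refine TopologicalGroupoid.continuousOn_mul.comp
          (f := fun p : E × E => (inv p.1, p.2)) ?_ fun p hp => ?_
        · exact ((TopologicalGroupoid.continuous_inv.comp continuous_fst).prodMk
            continuous_snd).continuousOn
        · exact (ArrowGroupoid.s_inv p.1).trans hp
      intro V hV
      rw [hval σ ρ (hKU hγK) hρ] at hV
      have hV' := hF (ρ, σ) hρ hV
      rw [mem_map, mem_nhdsWithin_iff_exists_mem_nhds_inter] at hV'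
      obtain ⟨N, hN, hNV⟩ := hV'
      obtain ⟨O, hO, O', hO', hOO⟩ := mem_nhds_prod_iff.1 hN
      -- the points of `U` lying below `O` have a neighbourhood of `r(σ)` as set of ranges
      have h1 : rng '' (T.proj '' O ∩ U) ∈ 𝓝 (rng (T.proj σ)) := by
        rw [← hγ]
        exact TopologicalGroupoid.isOpenMap_rng.image_mem_nhds
          (inter_mem (T.isOpenMap_proj.image_mem_nhds hO) (hUo.mem_nhds (hKU hγK)))
      have h2 := (continuous_rng.comp T.continuous_proj).continuousAt.preimage_mem_nhds h1
      rw [mem_map]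
      filter_upwards [hO', h2] with σ' hσ' hσ2
      obtain ⟨_, ⟨⟨ρ', hρ', rfl⟩, hρU⟩, hρr⟩ := hσ2
      have h3 : r ρ' = r σ' := T.r_eq_of_rng hρr
      rw [Set.mem_preimage, hval σ' ρ' hρU h3]
      exact hNV ⟨hOO (Set.mk_mem_prod hρ' hσ'), h3⟩
    · have h1 : (rng '' K)ᶜ ∈ 𝓝 (rng (T.proj σ)) :=
        (hK.image continuous_rng).isClosed.isOpen_compl.mem_nhds hσ
      have h2 := (continuous_rng.comp T.continuous_proj).continuousAt.preimage_mem_nhds h1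
      refine (continuousAt_const (y := (0 : ℂ))).congr ?_
      filter_upwards [h2] with σ' hσ'
      exact (hval0 σ' hσ').symm
  · intro ε hε
    have hM' : 0 < |M| + 1 := by positivity
    obtain ⟨K', hK', hbK'⟩ := hb0 (ε / (|M| + 1)) (by positivity)
    -- `h` is small off the product set `K K'`
    refine ⟨(fun p : G × G => mul p.1 p.2) '' ((K ×ˢ K') ∩ {p | s p.1 = r p.2}), ?_, ?_⟩
    · refine IsCompact.image_of_continuousOn ?_
        (TopologicalGroupoid.continuousOn_mul.mono Set.inter_subset_right)
      exact (hK.prod hK').inter_right (isClosed_eq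
        (TopologicalGroupoid.continuous_s.comp continuous_fst)
        (TopologicalGroupoid.continuous_r.comp continuous_snd))
    · intro σ hσ
      by_cases hσK : rng (T.proj σ) ∈ rng '' K
      · obtain ⟨γ, hγK, hγ⟩ := hσK
        obtain ⟨ρ, rfl, hρ⟩ := hlift σ γ (hKU hγK) hγ
        have hc : s (inv ρ) = r σ := (ArrowGroupoid.s_inv ρ).trans hρ
        have hc' : s ρ = r (mul (inv ρ) σ) := by
          rw [ArrowGroupoid.r_mul _ _ hc, ArrowGroupoid.r_inv]
        rw [hval σ ρ (hKU hγK) hρ, norm_mul]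
        have h1 : ‖b (mul (inv ρ) σ)‖ ≤ ε / (|M| + 1) := by
          apply hbK'
          intro h2
          refine hσ ⟨(T.proj ρ, T.proj (mul (inv ρ) σ)), ⟨⟨hγK, h2⟩, ?_⟩, ?_⟩
          · exact congrArg Subtype.val (T.src_proj_eq_rng_proj hc')
          · change mul (T.proj ρ) (T.proj (mul (inv ρ) σ)) = _
            rw [← T.proj_mul _ _ hc', mul_inv_mul_cancel_left hρ]
        calc ‖f ρ‖ * ‖b (mul (inv ρ) σ)‖ ≤ (|M| + 1) * (ε / (|M| + 1)) := by
              apply mul_le_mul _ h1 (norm_nonneg _) hM'.le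
              exact (hM ρ).trans ((le_abs_self M).trans (by linarith))
          _ = ε := by field_simp
      · rw [hval0 σ hσK, norm_zero]
        exact hε.le

end Twist

namespace Twist

variable {G E : Type*} [TopologicalSpace G] [TopologicalGroupoid G]
  [TopologicalSpace E] [TopologicalGroupoid E] {T : Twist G E}

/-! ### Continuity and decay of the sections of elements of the reduced C⋆-algebra -/

theorem VanishesAtInfinity.add {b c : E → ℂ} (hb : T.VanishesAtInfinity b)
    (hc : T.VanishesAtInfinity c) : T.VanishesAtInfinity (b + c) := by
  intro ε hε
  obtain ⟨K, hK, hbK⟩ := hb (ε / 2) (half_pos hε)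
  obtain ⟨K', hK', hcK⟩ := hc (ε / 2) (half_pos hε)
  refine ⟨K ∪ K', hK.union hK', fun σ hσ => ?_⟩
  rw [← add_halves ε]
  exact (norm_add_le _ _).trans
    (add_le_add (hbK σ fun h => hσ (Or.inl h)) (hcK σ fun h => hσ (Or.inr h)))

theorem VanishesAtInfinity.smul (c : ℂ) {b : E → ℂ} (hb : T.VanishesAtInfinity b) :
    T.VanishesAtInfinity (fun σ => c * b σ) := by
  intro ε hε
  obtain ⟨K, hK, hbK⟩ := hb (ε / (‖c‖ + 1)) (by positivity)
  refine ⟨K, hK, fun σ hσ => ?_⟩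
  calc ‖c * b σ‖ ≤ (‖c‖ + 1) * (ε / (‖c‖ + 1)) := by
        rw [norm_mul]
        exact mul_le_mul (by linarith) (hbK σ hσ) (norm_nonneg _) (by positivity)
    _ = ε := by field_simp

theorem vanishesAtInfinity_zero : T.VanishesAtInfinity (0 : E → ℂ) := fun ε hε =>
  ⟨∅, isCompact_empty, fun σ _ => by simpa using hε.le⟩

/-- The section of `a` is a continuous section of the line bundle vanishing at infinity. -/
def HasC0Section (a : T.BoundedFamilies) : Prop :=
  Continuous (toSection a) ∧ T.VanishesAtInfinity (toSection a)

namespace HasC0Section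

variable {a b : T.BoundedFamilies}

theorem add (ha : HasC0Section a) (hb : HasC0Section b) : HasC0Section (a + b) := by
  have h : toSection (a + b) = toSection a + toSection b := funext fun σ => toSection_add a b σ
  rw [HasC0Section, h]
  exact ⟨ha.1.add hb.1, ha.2.add hb.2⟩

theorem smul (c : ℂ) (ha : HasC0Section a) : HasC0Section (c • a) := by
  have h : toSection (c • a) = fun σ => c * toSection a σ := funext fun σ => toSection_smul c a σ
  rw [HasC0Section, h]
  exact ⟨continuous_const.mul ha.1, ha.2.smul c⟩

theorem zero : HasC0Section (0 : T.BoundedFamilies) := by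
  have h : toSection (0 : T.BoundedFamilies) = 0 := funext fun σ => toSection_zero σ
  rw [HasC0Section, h]
  exact ⟨continuous_zero, vanishesAtInfinity_zero⟩

theorem of_mem_closure {S : Set T.BoundedFamilies} (hS : ∀ b ∈ S, HasC0Section b)
    (ha : a ∈ closure S) : HasC0Section a := by
  have happ : ∀ ε > 0, ∃ b ∈ S, ∀ σ, ‖toSection a σ - toSection b σ‖ < ε := by
    intro ε hε
    obtain ⟨b, hb, hab⟩ := Metric.mem_closure_iff.1 ha ε hε
    refine ⟨b, hb, fun σ => ?_⟩
    rw [← toSection_sub]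
    exact (norm_toSection_le _ σ).trans_lt (by rwa [← dist_eq_norm])
  constructor
  · apply continuous_of_uniform_approx_of_continuous
    intro u hu
    obtain ⟨ε, hε, hεu⟩ := Metric.mem_uniformity_dist.1 hu
    obtain ⟨b, hb, hab⟩ := happ ε hε
    exact ⟨toSection b, (hS b hb).1, fun σ => hεu (by rw [dist_eq_norm]; exact hab σ)⟩
  · intro ε hε
    obtain ⟨b, hb, hab⟩ := happ (ε / 2) (half_pos hε)
    obtain ⟨K, hK, hbK⟩ := (hS b hb).2 (ε / 2) (half_pos hε)
    refine ⟨K, hK, fun σ hσ => ?_⟩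
    calc ‖toSection a σ‖ = ‖(toSection a σ - toSection b σ) + toSection b σ‖ := by
          rw [sub_add_cancel]
      _ ≤ ε / 2 + ε / 2 := (norm_add_le _ _).trans (add_le_add (hab σ).le (hbK σ hσ))
      _ = ε := add_halves ε

theorem reg [IsEtale G] (f : T.CcSection) : HasC0Section f.reg := by
  rw [HasC0Section, f.toSection_reg]
  refine ⟨f.continuous, fun ε hε => ⟨_, f.compactSupport, fun σ hσ => ?_⟩⟩
  have h : f.toFun σ = 0 := by
    by_contra hne
    exact hσ (subset_closure ⟨σ, hne, rfl⟩)
  rw [h, norm_zero]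
  exact hε.le

/-- Left multiplication by `π(f)` is convolution by `f`. A partition of unity cuts `f` into
sections supported in open sets on which the range map is injective. -/
theorem reg_mul [T2Space G] [LocallyCompactSpace G] [IsEtale G] (f : T.CcSection)
    (hb : HasC0Section b) : HasC0Section (f.reg * b) := by
  obtain ⟨M, -, hM⟩ := f.exists_norm_le
  choose e he1 he2 using (isLocalHomeomorph_both G).1
  obtain ⟨t, -, ht⟩ := f.compactSupport.elim_nhds_subcover (fun γ => (e γ).source)
    fun γ _ => (e γ).open_source.mem_nhds (he1 γ)
  let U : Fin t.card → Set G := fun i => (e (t.equivFin.symm i).1).source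
  have hUinj : ∀ i, Set.InjOn rng (U i) := fun i => by
    have h := (e (t.equivFin.symm i).1).injOn
    rwa [← he2] at h
  obtain ⟨φ, hφU, hφ1, hφ01, hφc⟩ := exists_continuous_sum_one_of_isOpen_isCompact (s := U)
    (fun i => (e _).open_source) f.compactSupport (by
      refine ht.trans (Set.iUnion₂_subset fun γ hγ => ?_)
      have h := Set.subset_iUnion U (t.equivFin ⟨γ, hγ⟩)
      simpa only [U, Equiv.symm_apply_apply] using h)
  have hconv : ∀ i, ∃ h : E → ℂ, Continuous h ∧ T.VanishesAtInfinity h ∧ ∀ σ,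
      HasSum (fun γ : {γ : G // src γ = src (T.proj σ)} =>
        (φ i (T.proj (mul σ (inv (T.lift γ.1)))) : ℂ) * f.coeff σ (T.lift γ.1) *
          toSection b (T.lift γ.1)) (h σ) := by
    intro i
    refine exists_conv_of_injOn (f := fun σ => (φ i (T.proj σ) : ℂ) * f.toFun σ)
      (U := U i) (K := tsupport (φ i)) (M := M) (e _).open_source (hUinj i) (hφc i) (hφU i)
      (fun z σ => ?_) (toSection_act b) ?_ hb.1 (fun σ hσ => ?_) (fun σ => ?_) hb.2
    · rw [T.proj_act, f.equivariant, mul_assoc]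
    · exact (Complex.continuous_ofReal.comp ((φ i).continuous.comp T.continuous_proj)).mul
        f.continuous
    · apply subset_tsupport
      exact fun h => left_ne_zero_of_mul hσ (by rw [h, Complex.ofReal_zero])
    · rw [norm_mul, Complex.norm_real, Real.norm_of_nonneg (hφ01 i _).1]
      exact (mul_le_of_le_one_left (norm_nonneg _) (hφ01 i _).2).trans (hM σ)
  choose h hc h0 hs using hconv
  have hsec : toSection (f.reg * b) = ∑ i, h i := by
    funext σ
    rw [Finset.sum_apply]
    have h1 : toSection (f.reg * b) σ = f.convSum (b.component _ (T.unitVector _)) σ := rfl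
    have h2 := hasSum_sum fun i (_ : i ∈ Finset.univ) => hs i σ
    rw [h1, CcSection.convSum_eq_tsum_value, ← h2.tsum_eq]
    refine tsum_congr fun γ => ?_
    rw [value_component_unitVector, ← Finset.sum_mul, ← Finset.sum_mul]
    congr 1
    by_cases hf : f.coeff σ (T.lift γ.1) = 0
    · rw [hf, mul_zero]
    · have h3 := hφ1 (subset_closure ⟨_, hf, rfl⟩ :
        T.proj (mul σ (inv (T.lift γ.1))) ∈ closure (T.openSupport f.toFun))
      rw [Finset.sum_apply] at h3
      rw [← Complex.ofReal_sum, h3, Pi.one_apply, Complex.ofReal_one, one_mul]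
  rw [HasC0Section, hsec]
  exact Finset.sum_induction h (fun g => Continuous g ∧ T.VanishesAtInfinity g)
    (fun _ _ h1 h2 => ⟨h1.1.add h2.1, h1.2.add h2.2⟩) ⟨continuous_zero, vanishesAtInfinity_zero⟩
    fun i _ => ⟨hc i, h0 i⟩

end HasC0Section

/-- Elements of the reduced C⋆-algebra are determined by their sections, which are continuous and
vanish at infinity. -/
theorem isInvariant_and_hasC0Section [T2Space G] [LocallyCompactSpace G] [IsEtale G]
    {a : T.BoundedFamilies} (ha : a ∈ T.reducedCStarAlgebra) : IsInvariant a ∧ HasC0Section a := by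
  -- a condition on `a` which, unlike the conclusion, is visibly stable under products
  let P : T.BoundedFamilies → Prop := fun a =>
    (IsInvariant a ∧ HasC0Section a) ∧ ∀ b, HasC0Section b → HasC0Section (a * b)
  have hreg : ∀ f : T.CcSection, P f.reg := fun f =>
    ⟨⟨f.isInvariant_reg, HasC0Section.reg f⟩, fun b hb => hb.reg_mul f⟩
  have hadd : ∀ a b, P a → P b → P (a + b) := fun a b ha hb =>
    ⟨⟨ha.1.1.add hb.1.1, ha.1.2.add hb.1.2⟩, fun c hc => by
      rw [add_mul]; exact (ha.2 c hc).add (hb.2 c hc)⟩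
  have hsmul : ∀ (c : ℂ) a, P a → P (c • a) := fun c a ha =>
    ⟨⟨ha.1.1.smul c, ha.1.2.smul c⟩, fun d hd => by
      rw [smul_mul_assoc]; exact (ha.2 d hd).smul c⟩
  have hmul : ∀ a b, P a → P b → P (a * b) := fun a b ha hb =>
    ⟨⟨ha.1.1.mul hb.1.1, ha.2 b hb.1.2⟩, fun c hc => by
      rw [mul_assoc]; exact ha.2 _ (hb.2 c hc)⟩
  have hzero : P 0 := ⟨⟨IsInvariant.zero, HasC0Section.zero⟩, fun c _ => by
    rw [zero_mul]; exact HasC0Section.zero⟩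
  have hadj : ∀ b ∈ NonUnitalStarAlgebra.adjoin ℂ (Set.range (CcSection.reg (T := T))),
      P b ∧ P (star b) := by
    intro b hb
    induction hb using NonUnitalStarAlgebra.adjoin_induction with
    | mem b hb =>
      obtain ⟨f, rfl⟩ := hb
      exact ⟨hreg f, f.star_reg ▸ hreg _⟩
    | add b c _ _ hb hc => exact ⟨hadd _ _ hb.1 hc.1, star_add b c ▸ hadd _ _ hb.2 hc.2⟩
    | zero => exact ⟨hzero, by rwa [star_zero]⟩
    | mul b c _ _ hb hc => exact ⟨hmul _ _ hb.1 hc.1, star_mul b c ▸ hmul _ _ hc.2 hb.2⟩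
    | smul c b _ hb => exact ⟨hsmul _ _ hb.1, star_smul c b ▸ hsmul _ _ hb.2⟩
    | star b _ hb => exact ⟨hb.2, (star_star b).symm ▸ hb.1⟩
  have hcl : a ∈ closure
      (NonUnitalStarAlgebra.adjoin ℂ (Set.range (CcSection.reg (T := T))) : Set _) := ha
  exact ⟨IsInvariant.of_mem_closure (fun b hb => (hadj b hb).1.1.1) hcl,
    HasC0Section.of_mem_closure (fun b hb => (hadj b hb).1.1.2) hcl⟩

theorem isOpen_supp' [T2Space G] [LocallyCompactSpace G] [IsEtale G]
    {a : T.BoundedFamilies} (ha : a ∈ T.reducedCStarAlgebra) : IsOpen (supp' a) :=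
  T.isOpenMap_proj _ (isOpen_ne_fun (isInvariant_and_hasC0Section ha).2.1 continuous_const)

theorem reg_mem_reducedCStarAlgebra [IsEtale G] (f : T.CcSection) :
    f.reg ∈ T.reducedCStarAlgebra :=
  NonUnitalStarSubalgebra.le_topologicalClosure _ (NonUnitalStarAlgebra.subset_adjoin ℂ _ ⟨f, rfl⟩)

end Twist

namespace Twist

variable {G E : Type*} [TopologicalSpace G] [TopologicalGroupoid G]
  [TopologicalSpace E] [TopologicalGroupoid E] {T : Twist G E}

/-! ### The commutant of `C₀(G⁽⁰⁾)` -/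

variable (G) in
theorem locallyCompactSpace_unitSpace [T2Space G] [LocallyCompactSpace G] :
    LocallyCompactSpace (unitSpace G) :=
  (isClosed_unitSpace G).isClosedEmbedding_subtypeVal.locallyCompactSpace

theorem mulOp_basisVec (h : ZeroAtInftyContinuousMap (unitSpace G) ℂ) {x : unitSpace G} (ρ : E)
    (hρ : src (T.proj ρ) = x) :
    T.mulOp h x (T.basisVec ρ x hρ) = h (rng (T.proj ρ)) • T.basisVec ρ x hρ := by
  apply T.value_ext
  intro σ hσ
  rw [value_mulOp, value_smul]
  by_cases hne : T.proj σ = T.proj ρ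
  · rw [hne]
  · rw [value_basisVec_of_ne _ _ _ _ hne, mul_zero, mul_zero]

theorem exists_zeroAtInfty_separating [T2Space G] [LocallyCompactSpace G] {x y : unitSpace G}
    (hxy : x ≠ y) : ∃ h : ZeroAtInftyContinuousMap (unitSpace G) ℂ, h x ≠ h y := by
  have := locallyCompactSpace_unitSpace G
  obtain ⟨φ, hφ1, hφ0, hφc, -⟩ := exists_continuous_one_zero_of_isCompact
    (isCompact_singleton (x := x)) (isClosed_singleton (x := y)) (by simpa using hxy)
  refine ⟨⟨⟨fun z => (φ z : ℂ), Complex.continuous_ofReal.comp φ.continuous⟩, ?_⟩, ?_⟩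
  · have h1 := HasCompactSupport.is_zero_at_infty hφc
    have h2 := (Complex.continuous_ofReal.tendsto 0).comp h1
    rwa [Complex.ofReal_zero] at h2
  · change (φ x : ℂ) ≠ (φ y : ℂ)
    rw [hφ1 rfl, hφ0 rfl]
    simp

theorem supp'_subset_isotropy [T2Space G] [LocallyCompactSpace G] {a : T.BoundedFamilies}
    (h : ∀ b ∈ T.unitSubalgebra, a * b = b * a) : supp' a ⊆ isotropy G := by
  rintro _ ⟨σ, hσ, rfl⟩
  by_contra hne
  obtain ⟨k, hk⟩ := exists_zeroAtInfty_separating (x := src (T.proj σ)) (y := rng (T.proj σ))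
    fun h1 => hne (congrArg Subtype.val h1).symm
  have h1 := h (T.unitHom k) ⟨k, rfl⟩
  -- both products applied to the unit vector at `s(σ)`, evaluated at `σ`
  have h2 : T.value (a.component _ (T.mulOp k _ (T.unitVector (src (T.proj σ))))) σ rfl =
      T.value (T.mulOp k _ (a.component _ (T.unitVector (src (T.proj σ))))) σ rfl :=
    congrArg (fun c : T.BoundedFamilies => toSection c σ) h1
  rw [value_mulOp, unitVector_eq_basisVec, mulOp_basisVec, map_smul, value_smul, T.rng_proj_incl,
    ← unitVector_eq_basisVec] at h2
  exact hk (mul_right_cancel₀ hσ h2)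

theorem commute_of_supp'_subset {a : T.BoundedFamilies} (ha : IsInvariant a)
    (h : supp' a ⊆ isotropy G) : ∀ b ∈ T.unitSubalgebra, a * b = b * a := by
  rintro _ ⟨k, rfl⟩
  apply BoundedFamilies.ext
  intro x
  apply T.clm_ext
  intro ρ hρ
  apply T.value_ext
  intro σ hσ
  change T.value (a.component x (T.mulOp k x (T.basisVec ρ x hρ))) σ hσ =
    T.value (T.mulOp k x (a.component x (T.basisVec ρ x hρ))) σ hσ
  rw [value_mulOp, mulOp_basisVec, map_smul, value_smul, ha.value_basisVec]
  by_cases h0 : toSection a (mul σ (inv ρ)) = 0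
  · rw [h0, mul_zero, mul_zero]
  · have hs : src (T.proj σ) = src (T.proj ρ) := hσ.trans hρ.symm
    have h1 : rng (T.proj (mul σ (inv ρ))) = src (T.proj (mul σ (inv ρ))) :=
      Subtype.ext (h ⟨_, h0, rfl⟩)
    rw [← T.rng_proj_mul_inv hs, h1, T.src_proj_mul_inv hs]

/-! ### The sections of elements of `C₀(G⁽⁰⁾)` -/

variable (T) in
/-- The section equal to `z̄` at `(z, x) ∈ 𝕋 × G⁽⁰⁾` and to `0` off `𝕋 × G⁽⁰⁾`. -/
noncomputable def unitSection (σ : E) : ℂ := T.value (T.unitVector (src (T.proj σ))) σ rfl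

theorem unitSection_incl (z : Circle) (x : unitSpace G) :
    T.unitSection (T.incl (z, x)) = conj (z : ℂ) := by
  have h : ∀ (y : unitSpace G) (hy : src (T.proj (T.incl (z, x))) = y),
      T.value (T.unitVector y) (T.incl (z, x)) hy = conj (z : ℂ) := by
    intro y hy
    obtain rfl : x = y := (T.src_proj_incl z x).symm.trans hy
    exact T.value_unitVector z
  exact h _ rfl

theorem unitSection_eq_zero {σ : E} (h : T.proj σ ∉ unitSpace G) : T.unitSection σ = 0 :=
  T.value_unitVector_of_ne _ fun h1 => h (h1 ▸ Subtype.coe_prop _)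

theorem unitSection_act (z : Circle) (σ : E) :
    T.unitSection (T.act z σ) = T.unitSection σ * conj (z : ℂ) := by
  by_cases h : T.proj σ ∈ unitSpace G
  · obtain ⟨w, x, rfl⟩ := T.exact σ h
    rw [T.act_incl, unitSection_incl, unitSection_incl, Circle.coe_mul, map_mul, mul_comm]
  · rw [unitSection_eq_zero h, unitSection_eq_zero (by rwa [T.proj_act]), zero_mul]

variable (T) in
/-- The unit section is continuous because `G⁽⁰⁾` is both open and closed in `G`. -/
theorem continuous_unitSection [T2Space G] [IsEtale G] : Continuous T.unitSection := by
  have hrange : Set.range T.incl = T.proj ⁻¹' unitSpace G := by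
    ext σ
    constructor
    · rintro ⟨⟨z, x⟩, rfl⟩
      rw [Set.mem_preimage, T.proj_incl]
      exact x.2
    · intro h
      obtain ⟨z, x, rfl⟩ := T.exact σ h
      exact ⟨_, rfl⟩
  have hopen : Topology.IsOpenEmbedding T.incl :=
    ⟨T.isEmbedding_incl, hrange ▸ (isOpen_unitSpace G).preimage T.continuous_proj⟩
  rw [continuous_iff_continuousAt]
  intro σ
  by_cases h : T.proj σ ∈ unitSpace G
  · obtain ⟨z, x, rfl⟩ := T.exact σ h
    rw [← hopen.continuousAt_iff]
    have h1 : T.unitSection ∘ T.incl = fun p : Circle × unitSpace G => conj (p.1 : ℂ) :=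
      funext fun p => unitSection_incl p.1 p.2
    rw [h1]
    exact (Complex.continuous_conj.comp
      (continuous_circle_coe.comp continuous_fst)).continuousAt
  · refine (continuousAt_const (y := (0 : ℂ))).congr ?_
    filter_upwards [((isClosed_unitSpace G).preimage T.continuous_proj).isOpen_compl.mem_nhds h]
      with τ hτ
    exact (unitSection_eq_zero hτ).symm

theorem toSection_unitHom (h : ZeroAtInftyContinuousMap (unitSpace G) ℂ) (σ : E) :
    toSection (T.unitHom h) σ = h (rng (T.proj σ)) * T.unitSection σ :=
  T.value_mulOp h _ σ rfl

theorem supp'_unitHom_subset (h : ZeroAtInftyContinuousMap (unitSpace G) ℂ) :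
    supp' (T.unitHom h) ⊆ unitSpace G := by
  rintro _ ⟨σ, hσ, rfl⟩
  by_contra hne
  exact hσ (by rw [toSection_unitHom, unitSection_eq_zero hne, mul_zero])

theorem unitHom_mem_of_hasCompactSupport [T2Space G] [IsEtale G]
    (h : ZeroAtInftyContinuousMap (unitSpace G) ℂ) (hc : HasCompactSupport h) :
    T.unitHom h ∈ T.reducedCStarAlgebra := by
  let f : T.CcSection :=
    { toFun := fun σ => h (rng (T.proj σ)) * T.unitSection σ
      equivariant := fun z σ => by rw [T.proj_act, unitSection_act, mul_assoc]
      continuous := (h.continuous.comp (continuous_rng.comp T.continuous_proj)).mul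
        T.continuous_unitSection
      compactSupport := by
        have h1 : T.openSupport (fun σ => h (rng (T.proj σ)) * T.unitSection σ) ⊆
            Subtype.val '' tsupport h := by
          rintro _ ⟨σ, hσ, rfl⟩
          have hu : T.proj σ ∈ unitSpace G := by
            by_contra hne
            exact right_ne_zero_of_mul hσ (unitSection_eq_zero hne)
          exact ⟨rng (T.proj σ), subset_tsupport _ (left_ne_zero_of_mul hσ), hu⟩
        have h2 : IsCompact (Subtype.val '' tsupport h : Set G) :=
          IsCompact.image hc continuous_subtype_val
        exact h2.of_isClosed_subset isClosed_closure (closure_minimal h1 h2.isClosed) }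
  have h1 : f.reg = T.unitHom h := by
    apply f.isInvariant_reg.ext (IsInvariant.unitHom h)
    rw [f.toSection_reg]
    exact funext fun σ => (toSection_unitHom h σ).symm
  exact h1 ▸ reg_mem_reducedCStarAlgebra f

theorem unitSubalgebra_le [T2Space G] [LocallyCompactSpace G] [IsEtale G] :
    T.unitSubalgebra ≤ T.reducedCStarAlgebra := by
  have := locallyCompactSpace_unitSpace G
  rintro _ ⟨h, rfl⟩
  have hcl : IsClosed (T.reducedCStarAlgebra : Set T.BoundedFamilies) := isClosed_closure
  change T.unitHom h ∈ (T.reducedCStarAlgebra : Set T.BoundedFamilies)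
  rw [← hcl.closure_eq, Metric.mem_closure_iff]
  intro ε hε
  -- multiply `h` by a cutoff function equal to `1` where `h` is not small
  have h1 : ∀ᶠ x in Filter.cocompact (unitSpace G), ‖h x‖ < ε / 2 := by
    have := h.zero_at_infty'.norm
    rw [norm_zero] at this
    exact this.eventually_lt_const (half_pos hε)
  obtain ⟨K, hK, hKh⟩ := Filter.mem_cocompact.1 h1
  obtain ⟨φ, hφ1, -, hφc, hφ⟩ := exists_continuous_one_zero_of_isCompact hK isClosed_empty
    (Set.disjoint_empty K)
  let k : ZeroAtInftyContinuousMap (unitSpace G) ℂ :=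
    { toFun := fun x => (φ x : ℂ) * h x
      continuous_toFun := (Complex.continuous_ofReal.comp φ.continuous).mul h.continuous
      zero_at_infty' := by
        refine squeeze_zero_norm (a := fun x => ‖h x‖) (fun x => ?_) ?_
        · rw [norm_mul, Complex.norm_real, Real.norm_of_nonneg (hφ x).1]
          exact mul_le_of_le_one_left (norm_nonneg _) (hφ x).2
        · have := h.zero_at_infty'.norm
          rwa [norm_zero] at this }
  have hkc : HasCompactSupport k := by
    refine hφc.mono fun x hx => ?_
    have h2 : (φ x : ℂ) ≠ 0 := left_ne_zero_of_mul hx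
    exact_mod_cast h2
  refine ⟨T.unitHom k, unitHom_mem_of_hasCompactSupport k hkc, ?_⟩
  rw [dist_eq_norm, ← map_sub]
  refine lt_of_le_of_lt ?_ (half_lt_self hε)
  refine BoundedFamilies.norm_le _ (half_pos hε).le fun x => (norm_mulOp_le (h - k) x).trans ?_
  rw [← ZeroAtInftyContinuousMap.norm_toBCF_eq_norm]
  refine (BoundedContinuousFunction.norm_le (half_pos hε).le).2 fun x => ?_
  change ‖h x - (φ x : ℂ) * h x‖ ≤ ε / 2
  by_cases hx : x ∈ K
  · rw [hφ1 hx, Pi.one_apply, Complex.ofReal_one, one_mul, sub_self, norm_zero]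
    exact (half_pos hε).le
  · have h2 : ‖h x‖ < ε / 2 := hKh hx
    have h3 : h x - (φ x : ℂ) * h x = ((1 - φ x : ℝ) : ℂ) * h x := by push_cast; ring
    rw [h3, norm_mul, Complex.norm_real, Real.norm_of_nonneg (sub_nonneg.2 (hφ x).2)]
    exact (mul_le_of_le_one_left (norm_nonneg _) (by linarith [(hφ x).1])).trans h2.le

theorem mem_unitSubalgebra_of_supp'_subset [T2Space G] {a : T.BoundedFamilies}
    (ha : IsInvariant a) (ha0 : HasC0Section a) (h : supp' a ⊆ unitSpace G) :
    a ∈ T.unitSubalgebra := by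
  let k : ZeroAtInftyContinuousMap (unitSpace G) ℂ :=
    { toFun := fun x => toSection a (T.incl (1, x))
      continuous_toFun := ha0.1.comp
        (T.isEmbedding_incl.continuous.comp (Continuous.prodMk continuous_const continuous_id))
      zero_at_infty' := by
        rw [Metric.tendsto_nhds]
        intro ε hε
        obtain ⟨K, hK, haK⟩ := ha0.2 (ε / 2) (half_pos hε)
        refine Filter.mem_cocompact.2 ⟨Subtype.val ⁻¹' K,
          (isClosed_unitSpace G).isClosedEmbedding_subtypeVal.isCompact_preimage hK, fun x hx => ?_⟩
        change dist (toSection a (T.incl (1, x))) 0 < ε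
        rw [dist_zero_right]
        exact (haK _ (by rwa [T.proj_incl])).trans_lt (half_lt_self hε) }
  refine ⟨k, (IsInvariant.unitHom k).ext ha (funext fun σ => ?_)⟩
  rw [toSection_unitHom]
  by_cases hσ : T.proj σ ∈ unitSpace G
  · obtain ⟨z, x, rfl⟩ := T.exact σ hσ
    rw [T.rng_proj_incl, unitSection_incl]
    change toSection a (T.incl (1, x)) * _ = _
    rw [← toSection_act, T.act_incl, mul_one]
  · rw [unitSection_eq_zero hσ, mul_zero]
    by_contra hne
    exact hσ (h ⟨σ, fun h0 => hne h0.symm, rfl⟩)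

end Twist

/-! ### Maximal abelian self-adjoint subalgebras -/

/-- A masa is its own relative commutant. -/
theorem IsMasa.mem_of_commute {M : Type*} [NonUnitalCStarAlgebra M]
    {A B : NonUnitalStarSubalgebra ℂ M} (h : IsMasa A B) {a : M} (ha : a ∈ A)
    (hab : ∀ b ∈ B, a * b = b * a) : a ∈ B := by
  have hab' : ∀ b ∈ B, star a * b = b * star a := fun b hb => by
    have h1 := congrArg star (hab _ (star_mem hb))
    rw [star_mul, star_mul, star_star] at h1
    exact h1.symm
  -- a self-adjoint element of the commutant can be adjoined to `B`
  have key : ∀ c ∈ A, star c = c → (∀ b ∈ B, c * b = b * c) → c ∈ B := by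
    intro c hc hcs hcb
    let S : Set M := insert c (B : Set M)
    have hcomm : ∀ x ∈ S, ∀ y ∈ S, x * y = y * x := by
      rintro x (rfl | hx) y (rfl | hy)
      · rfl
      · exact hcb y hy
      · exact (hcb x hx).symm
      · exact h.prop.2 x hx y hy
    have hstar : ∀ y ∈ S, star y ∈ S := by
      rintro y (rfl | hy)
      · exact Or.inl hcs
      · exact Or.inr (star_mem hy)
    have hmul := NonUnitalStarAlgebra.isMulCommutative_adjoin ℂ hcomm
      fun x hx y hy => hcomm x hx _ (hstar y hy)
    have hSA : NonUnitalStarAlgebra.adjoin ℂ S ≤ A :=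
      NonUnitalStarAlgebra.adjoin_le (Set.insert_subset hc h.prop.1)
    have hBS : B ≤ NonUnitalStarAlgebra.adjoin ℂ S := fun b hb =>
      NonUnitalStarAlgebra.subset_adjoin ℂ S (Or.inr hb)
    exact h.le_of_ge ⟨hSA, fun x hx y hy => congrArg Subtype.val
        (hmul.is_comm.comm ⟨x, hx⟩ ⟨y, hy⟩)⟩ hBS
      (NonUnitalStarAlgebra.subset_adjoin ℂ S (Or.inl rfl))
  have hre : a + star a ∈ B := by
    refine key _ (add_mem ha (star_mem ha)) ?_ fun b hb => ?_
    · rw [star_add, star_star, add_comm]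
    · rw [add_mul, mul_add, hab b hb, hab' b hb]
  have him : Complex.I • (a - star a) ∈ B := by
    refine key _ (SMulMemClass.smul_mem _ (sub_mem ha (star_mem ha))) ?_ fun b hb => ?_
    · rw [star_smul, star_sub, star_star, ← neg_sub, smul_neg, ← neg_smul]
      simp
    · rw [smul_mul_assoc, mul_smul_comm, sub_mul, mul_sub, hab b hb, hab' b hb]
  have h1 : a = (1 / 2 : ℂ) • (a + star a) +
      (-Complex.I / 2 : ℂ) • (Complex.I • (a - star a)) := by
    have h2 : -Complex.I / 2 * Complex.I = 1 / 2 := by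
      rw [div_mul_eq_mul_div, neg_mul, Complex.I_mul_I, neg_neg]
    rw [smul_smul, h2]
    module
  rw [h1]
  exact add_mem (SMulMemClass.smul_mem _ hre) (SMulMemClass.smul_mem _ him)

namespace Twist

variable {G E : Type*} [TopologicalSpace G] [T2Space G] [LocallyCompactSpace G]
  [TopologicalGroupoid G] [IsEtale G] [TopologicalSpace E] [TopologicalGroupoid E]
  (T : Twist G E)

/-! ### Commutation with `C₀(G⁽⁰⁾)` and essential principality -/

theorem commute_iff_supp'_subset {a : T.BoundedFamilies} (ha : a ∈ T.reducedCStarAlgebra) :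
    (∀ b ∈ T.unitSubalgebra, a * b = b * a) ↔ supp' a ⊆ isotropy G :=
  ⟨supp'_subset_isotropy, commute_of_supp'_subset (isInvariant_and_hasC0Section ha).1⟩

theorem isMasa_unitSubalgebra_iff :
    IsMasa T.reducedCStarAlgebra T.unitSubalgebra ↔ IsEssentiallyPrincipal G := by
  refine ⟨fun hmasa => ?_, fun hG => ⟨⟨unitSubalgebra_le, ?_⟩, fun C hC hBC a ha => ?_⟩⟩
  · refine Set.Subset.antisymm (fun γ hγ => ?_)
      (interior_maximal unitSpace_subset_isotropy (isOpen_unitSpace G))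
    by_contra hne
    -- a section supported in the interior of the isotropy, off the units, commutes with `C₀(G⁽⁰⁾)`
    obtain ⟨σ, rfl⟩ := T.isOpenQuotientMap_proj.surjective γ
    have hW : IsOpen (interior (isotropy G) ∩ (unitSpace G)ᶜ) :=
      isOpen_interior.inter (isClosed_unitSpace G).isOpen_compl
    obtain ⟨f, hfσ, hf⟩ := T.exists_ccSection hW (σ := σ) ⟨hγ, hne⟩
    have hsupp : supp' f.reg ⊆ isotropy G := by
      rw [supp', f.toSection_reg]
      exact fun γ hγ => interior_subset (hf hγ).1
    have hmem := reg_mem_reducedCStarAlgebra f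
    obtain ⟨h, hh⟩ := hmasa.mem_of_commute hmem ((T.commute_iff_supp'_subset hmem).2 hsupp)
    have hh' : T.unitHom h = f.reg := hh
    refine hne (supp'_unitHom_subset (T := T) h ?_)
    rw [mem_supp', hh', f.toSection_reg]
    exact hfσ
  · rintro _ ⟨h, rfl⟩ _ ⟨k, rfl⟩
    change T.unitHom h * T.unitHom k = T.unitHom k * T.unitHom h
    rw [← map_mul, mul_comm, map_mul]
  · have haA := hC.1 ha
    obtain ⟨hinv, hc0⟩ := isInvariant_and_hasC0Section haA
    refine mem_unitSubalgebra_of_supp'_subset hinv hc0 ?_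
    have h1 : supp' a ⊆ isotropy G := (T.commute_iff_supp'_subset haA).1 fun b hb => hC.2 a ha b (hBC hb)
    exact (interior_maximal h1 (isOpen_supp' haA)).trans hG.subset

end Twist

end TwistedGroupoid

theorem mainTheorem4 {G E : Type*}
    [TopologicalSpace G] [T2Space G] [LocallyCompactSpace G] [SecondCountableTopology G]
    [TwistedGroupoid.TopologicalGroupoid G] [TwistedGroupoid.IsEtale G]
    [TopologicalSpace E] [TwistedGroupoid.TopologicalGroupoid E]
    (T : TwistedGroupoid.Twist G E) :
    (∀ a ∈ T.reducedCStarAlgebra,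
      (∀ b ∈ T.unitSubalgebra, a * b = b * a) ↔
        TwistedGroupoid.Twist.supp' a ⊆ TwistedGroupoid.isotropy G) ∧
    (TwistedGroupoid.IsMasa T.reducedCStarAlgebra T.unitSubalgebra ↔
      TwistedGroupoid.IsEssentiallyPrincipal G) := by
  exact ⟨fun _ ha => T.commute_iff_supp'_subset ha, T.isMasa_unitSubalgebra_iff⟩
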